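/- **Setting.** Let $B=\mathbb{R}/\mathbb{Z}$, let $X=T^*B/\Lambda^*\cong B\times\mathbb{R}/\mathbb{Z}$ with coordinates $(x,y)$ and symplectic form $dy\wedge dx$, and let $\check X=TB/\Lambda\cong B\times\mathbb{R}/\mathbb{Z}$ with coordinates $(x,\check y)$ be the mirror elliptic curve, with complex coordinate $z=\check y+ix$. A connected immersed Lagrangian multi-section of $X\to B$ is given by an integer $r>0$ (its rank), an integer $d$ and a smooth function $\varphi:\mathbb{R}\to\mathbb{R}$ (its defining equation) with $\varphi(x+r)=\varphi(x)+d$: its domain is $L=\mathbb{R}/r\mathbb{Z}$, its immersion is $\xi:L\to X$, $[x]\mapsto([x],[\varphi(x)])$, and its covering of $B$ is $[x]\mapsto[x]$. We say that it has degree $-d$; ranks and degrees are added over components. A $U(1)$-local system on it is given by the flat connection $d+2\pi i\frac{b}{r}dx$ on the trivial line bundle, $b\in\mathbb{R}$. The Poincaré bundle $\mathcal{P}\to X\times_B\check X$ is the quotient of $(T^*B\oplus TB)\times\mathbb{C}$ by the action of $\Lambda^*\oplus\Lambda$ generated by $(y,\check y,t)\mapsto(y+m,\check y,e^{-i\pi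 m\check y}t)$ and $(y,\check y,t)\mapsto(y,\check y+n,e^{i\pi ny}t)$, $m,n\in\mathbb{Z}$, with connection $\nabla_{\mathcal{P}}=d+i\pi(y\,d\check y-\check y\,dy)$. The SYZ mirror bundle of a multi-section $\mathbb{L}$ with components equipped with local systems, forming together a local system $\mathcal{L}$ on the total domain $L$, is $$\check{\mathbb{L}}=(\pi_{\check X})_*\big((\xi\times\mathrm{id}_{\check X})^*\mathcal{P}\otimes\pi_L^*\mathcal{L}\big),$$ a bundle on $\check X$ of rank equal to the rank of $\mathbb{L}$, with the holomorphic structure given by the $(0,1)$-part of the induced connection. For $r\in\mathbb{Z}_{>0}$, $d\in\mathbb{Z}$ and $c,b\in\mathbb{R}$ let $\mathbb{L}_{r,d}[c]$ be the multi-section with defining equation $\varphi(x)=\frac{d}{r}x+\frac{c}{r}$ (for $\gcd(r,d)=1$ this is the embedded line $\{(e^{2\pi irt},e^{2\pi i(dt+c)}):t\in\mathbb{R}\}$), and let $\mathbb{L}_{r,d}[c]_b$ be the same multi-section equipped with the local system $d+2\pi i\frac{b}{r}dx$. **Proposition 3.1.** Let $r_1,r_2$ be positive integers, $d_1,d_2\in\mathbb{Z}$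 and $c_1,c_2,b_1,b_2\in\mathbb{R}$. Let $\mathbb{L}$ be an immersed Lagrangian multi-section of rank $r_1+r_2$ and degree $-d_1-d_2$ whose components $\mathbb{L}'_1,\dots,\mathbb{L}'_M$ have ranks $r_j'$, degrees $-d_j'$ and defining equations $\varphi_j'$ (so $\sum_j r_j'=r_1+r_2$ and $\sum_j d_j'=d_1+d_2$), equipped with the local systems $d+2\pi i\frac{b_j'}{r_j'}dx$, $b_j'\in\mathbb{R}$. Denote by $\mathbb{L}_{b'}$ the resulting brane, and put $a_j'=\int_0^{r_j'}\varphi_j'(x)\,dx$. Then $\det(\check{\mathbb{L}}_{b'})$ and $\det(\check{\mathbb{L}}_{r_1,d_1}[c_1]_{b_1})\otimes\det(\check{\mathbb{L}}_{r_2,d_2}[c_2]_{b_2})$ are holomorphic line bundles on $\check X$, and $$\det(\check{\mathbb{L}}_{b'})\cong\det(\check{\mathbb{L}}_{r_1,d_1}[c_1]_{b_1})\otimes\det(\check{\mathbb{L}}_{r_2,d_2}[c_2]_{b_2})$$ as holomorphic line bundles if and only if $$\sum_{j=1}^M a_j'-\frac{r_1d_1}{2}-\frac{r_2d_2}{2}-c_1-c_2\in\mathbb{Z}\quad\text{and}\quad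 b_1+b_2-\frac{M}{2}-\sum_{j=1}^M b_j'\in\mathbb{Z}.$$ -/

import Mathlib

open scoped ContDiff TensorProduct

noncomputable section

namespace SYZ

/-- The symplectic torus `X = T^*B / Λ^*` over `B = ℝ/ℤ`, with coordinates `(x, y)`. -/
abbrev SymplecticTorus : Type := UnitAddCircle × UnitAddCircle

/-- The mirror elliptic curve `X̌ = TB / Λ` over `B = ℝ/ℤ`, with coordinates `(x, y̌)`. -/
abbrev MirrorCurve : Type := UnitAddCircle × UnitAddCircle

/-- The universal covering `ℂ → X̌`. The complex coordinate of `X̌` is `z = y̌ + i x`, so that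
`x = Im z`, `y̌ = Re z`, and multiplication by `i` on tangent vectors is the complex structure
`J(∂/∂y̌) = ∂/∂x`, `J(∂/∂x) = -∂/∂y̌`. -/
def toMirror (z : ℂ) : MirrorCurve := ((z.im : UnitAddCircle), (z.re : UnitAddCircle))

/-- `f` is a holomorphic function on the open subset `U` of the elliptic curve `X̌`. -/
def IsHolomorphicFunction (U : TopologicalSpace.Opens MirrorCurve) (f : MirrorCurve → ℂ) : Prop :=
  DifferentiableOn ℂ (fun z => f (toMirror z)) (toMirror ⁻¹' (U : Set MirrorCurve))

/-! ### Holomorphic bundles on the mirror curve, described by their holomorphic sections -/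

/-- A family of complex vector spaces over `X̌` together with the notion of a local holomorphic
section: `IsHol U s` says that `s` is holomorphic over the open set `U` (the values of `s`
outside `U` are irrelevant). Such a family is a holomorphic vector bundle when it has local
holomorphic frames, see `IsHolomorphicVectorBundle`. -/
structure BundleData where
  fiber : MirrorCurve → Type
  [addCommGroup : ∀ p, AddCommGroup (fiber p)]
  [module : ∀ p, Module ℂ (fiber p)]
  IsHol : TopologicalSpace.Opens MirrorCurve → (∀ p, fiber p) → Prop

attribute [instance] BundleData.addCommGroup BundleData.module

namespace BundleData

/-- `E` is a holomorphic vector bundle of rank `n`: every point has an open neighbourhood `U` with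
a frame `e₁, …, eₙ` such that the holomorphic sections over any open `V ⊆ U` are exactly the
combinations of the `eᵢ` with holomorphic coefficients. -/
def IsHolomorphicVectorBundle (E : BundleData) (n : ℕ) : Prop :=
  ∀ p : MirrorCurve, ∃ U : TopologicalSpace.Opens MirrorCurve, p ∈ U ∧
    ∃ e : Fin n → ∀ q, E.fiber q,
      (∀ q ∈ U, LinearIndependent ℂ (fun i => e i q) ∧
        Submodule.span ℂ (Set.range fun i => e i q) = ⊤) ∧
      ∀ V : TopologicalSpace.Opens MirrorCurve, V ≤ U → ∀ s : ∀ q, E.fiber q,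
        E.IsHol V s ↔ ∃ a : Fin n → MirrorCurve → ℂ,
          (∀ i, IsHolomorphicFunction V (a i)) ∧ ∀ q ∈ V, s q = ∑ i, a i q • e i q

/-- A holomorphic line bundle. -/
def IsHolomorphicLineBundle (E : BundleData) : Prop := E.IsHolomorphicVectorBundle 1

/-- The exterior power `⋀ⁿ E`; for `E` of rank `n` this is the determinant line bundle `det E`.
A section is holomorphic when it is locally a finite combination, with holomorphic coefficients, of
wedge products of holomorphic sections of `E`. -/
def det (n : ℕ) (E : BundleData) : BundleData where
  fiber p := ⋀[ℂ]^n (E.fiber p)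
  IsHol U w := ∀ p ∈ U, ∃ V : TopologicalSpace.Opens MirrorCurve, p ∈ V ∧ V ≤ U ∧
    ∃ (k : ℕ) (a : Fin k → MirrorCurve → ℂ) (e : Fin k → Fin n → ∀ q, E.fiber q),
      (∀ m, IsHolomorphicFunction V (a m)) ∧ (∀ m i, E.IsHol V (e m i)) ∧
      ∀ q ∈ V, w q = ∑ m, a m q • exteriorPower.ιMulti ℂ n (fun i => e m i q)

/-- The tensor product `E ⊗ F`. A section is holomorphic when it is locally a finite sum of tensor
products of holomorphic sections of `E` and `F`. -/
def tensor (E F : BundleData) : BundleData where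
  fiber p := E.fiber p ⊗[ℂ] F.fiber p
  IsHol U w := ∀ p ∈ U, ∃ V : TopologicalSpace.Opens MirrorCurve, p ∈ V ∧ V ≤ U ∧
    ∃ (k : ℕ) (e : Fin k → ∀ q, E.fiber q) (f : Fin k → ∀ q, F.fiber q),
      (∀ m, E.IsHol V (e m)) ∧ (∀ m, F.IsHol V (f m)) ∧
      ∀ q ∈ V, w q = ∑ m, e m q ⊗ₜ[ℂ] f m q

/-- Isomorphism of holomorphic bundles: a family of linear isomorphisms of the fibres which, over
every open set, matches the holomorphic sections of `E` with those of `F`. -/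
def Isomorphic (E F : BundleData) : Prop :=
  ∃ Φ : ∀ p, E.fiber p ≃ₗ[ℂ] F.fiber p,
    ∀ (U : TopologicalSpace.Opens MirrorCurve) (s : ∀ p, E.fiber p),
      E.IsHol U s ↔ F.IsHol U (fun p => Φ p (s p))

end BundleData

/-! ### Lagrangian multi-sections of `X → B` -/

/-- An immersed Lagrangian multi-section of `X → B = ℝ/ℤ` with connected domain, given by its
defining equation `y = φ(x)` on `ℝ`, where `φ (x + r) = φ x + d`. -/
structure Multisection where
  r : ℕ
  r_pos : 0 < r
  d : ℤ
  φ : ℝ → ℝ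
  smooth : ContDiff ℝ ∞ φ
  map_add : ∀ x : ℝ, φ (x + r) = φ x + d

namespace Multisection

/-- The domain `L = ℝ/rℤ`. -/
abbrev Domain (L : Multisection) : Type := AddCircle (L.r : ℝ)

theorem periodic (L : Multisection) : Function.Periodic
    (fun x : ℝ => (((x : UnitAddCircle), (L.φ x : UnitAddCircle)) : SymplecticTorus))
    (L.r : ℝ) := by
  have key (n : ℤ) : ((n : ℝ) : UnitAddCircle) = 0 := by
    rw [AddCircle.coe_eq_zero_iff]
    exact ⟨n, by simp⟩
  intro x
  have h1 : ((L.r : ℝ) : UnitAddCircle) = 0 := by exact_mod_cast key L.r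
  simp only [L.map_add, AddCircle.coe_add, h1, key, add_zero]

/-- The immersion `ξ : L → X`, `ξ [x] = ([x], [φ x])`. -/
def immersion (L : Multisection) : L.Domain → SymplecticTorus := L.periodic.lift

/-- The `r`-fold covering `c_r = π_B ∘ ξ : L → B`, `[x] ↦ [x]`. -/
def cover (L : Multisection) (l : L.Domain) : UnitAddCircle := (L.immersion l).1

/-- The straight line `𝕃_{r,d}[c]`, with defining equation `φ(x) = (d / r) x + c / r`. For coprime
`r` and `d` it is the embedded line `{(e^{2πi r t}, e^{2πi (d t + c)}) : t ∈ ℝ}`. -/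
def line (r : ℕ) (hr : 0 < r) (d : ℤ) (c : ℝ) : Multisection where
  r := r
  r_pos := hr
  d := d
  φ x := d / r * x + c / r
  smooth := by fun_prop
  map_add x := by
    have : (r : ℝ) ≠ 0 := by exact_mod_cast hr.ne'
    field_simp
    ring

end Multisection

/-! ### The Poincaré bundle and the SYZ transform -/

/-- The fibre of the Poincaré line bundle over a point with fibre coordinates `([y], [y̌])`. The
Poincaré bundle is the quotient of the trivial line bundle over `T^*B ⊕ TB` by the action of
`Λ^* ⊕ Λ` generated by
`(m, 0) · (y, y̌, t) = (y + m, y̌, e^{-iπ m y̌} t)` and `(0, n) · (y, y̌, t) = (y, y̌ + n, e^{iπ n y} t)`,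
so that `(m, n) · (y, y̌, t) = (y + m, y̌ + n, e^{iπ (n y - m y̌ + m n)} t)`.
A point of the fibre of the quotient is represented by the function `u` on the set of all lifts
`(y, y̌)` which assigns to `(y, y̌)` the unique `t = u (y, y̌)` such that `(y, y̌, t)` represents this
point. -/
def poincareFiber (η θ : UnitAddCircle) :
    Submodule ℂ ({v : ℝ × ℝ // (v.1 : UnitAddCircle) = η ∧ (v.2 : UnitAddCircle) = θ} → ℂ) where
  carrier := {u | ∀ v w, ∀ m n : ℤ, w.1.1 = v.1.1 + (m : ℝ) → w.1.2 = v.1.2 + (n : ℝ) →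
    u w = Complex.exp (Complex.I * Real.pi * (n * v.1.1 - m * v.1.2 + m * n)) * u v}
  zero_mem' := by
    intro v w m n _ _
    simp
  add_mem' := by
    intro a b ha hb v w m n h1 h2
    simp only [Pi.add_apply, ha v w m n h1 h2, hb v w m n h1 h2]
    ring
  smul_mem' := by
    intro t a ha v w m n h1 h2
    simp only [Pi.smul_apply, ha v w m n h1 h2, smul_eq_mul]
    ring

variable {M : ℕ}

/-- The domain of a multi-section with components `L 0, …, L (M - 1)`. -/
abbrev TotalDomain (L : Fin M → Multisection) : Type := Σ j, (L j).Domain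

/-- The fibre at `p = (x, y̌)` of the pushforward to `X̌` of the line bundle
`(ξ × id)^* 𝒫 ⊗ π_L^* ℒ` on `L ×_B X̌`: the direct sum, over the points `l ∈ L` above `x ∈ B`, of
the fibres of the Poincaré bundle at `(ξ(l), p)`. The complex line bundle underlying the local
system `ℒ` is the trivial one. -/
abbrev mirrorFiber (L : Fin M → Multisection) (p : MirrorCurve) : Type :=
  ∀ l : {l : TotalDomain L // (L l.1).cover l.2 = p.1},
    poincareFiber ((L l.1.1).immersion l.1.2).2 p.2

/-- A section of the pushforward is a section over `L ×_B X̌`; this is its pullback to the universal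
covering `ℂ` of the component `L_j ×_B X̌`, as a function `ℂ → ℂ` in the trivialization of the
Poincaré bundle over `T^*B ⊕ TB`: the point `z = y̌ + i x` is mapped to
`(y, y̌) = (φ_j(x), y̌)`. -/
def pullback (L : Fin M → Multisection) (s : ∀ p, mirrorFiber L p) (j : Fin M) (z : ℂ) : ℂ :=
  (s (toMirror z) ⟨⟨j, ((z.im : ℝ) : (L j).Domain)⟩, rfl⟩).1 ⟨((L j).φ z.im, z.re), rfl, rfl⟩

/-- The covariant derivative, along the tangent vector `v = v_{y̌} + i v_x`, for the connection
induced by `∇_𝒫 = d + iπ (y dy̌ - y̌ dy)` (with `y = φ(x)`, `dy = φ'(x) dx`) and the flat connection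
`d + 2πi (b / r) dx` of the local system. -/
def covDeriv (L : Multisection) (b : ℝ) (σ : ℂ → ℂ) (z v : ℂ) : ℂ :=
  fderiv ℝ σ z v
    + Complex.I * Real.pi * (L.φ z.im * v.re - z.re * (deriv L.φ z.im * v.im)) * σ z
    + 2 * Real.pi * Complex.I * (b / L.r) * v.im * σ z

/-- The SYZ mirror bundle of the A-brane whose components are the multi-sections `L j` with the
local systems `d + 2πi (b j / r j) dx`. The holomorphic sections are the smooth sections annihilated
by the `(0,1)`-part of the connection, i.e. `∇_v s + i ∇_{J v} s = 0`. -/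
def mirror (L : Fin M → Multisection) (b : Fin M → ℝ) : BundleData where
  fiber p := mirrorFiber L p
  IsHol U s := ∀ j,
    ContDiffOn ℝ ∞ (pullback L s j) (toMirror ⁻¹' (U : Set MirrorCurve)) ∧
    ∀ z ∈ toMirror ⁻¹' (U : Set MirrorCurve), ∀ v : ℂ,
      covDeriv (L j) (b j) (pullback L s j) z v
        + Complex.I * covDeriv (L j) (b j) (pullback L s j) z (Complex.I * v) = 0

/-- The rank of a multi-section: the number of sheets over `B`, which is the rank of its mirror. -/
def rank (L : Fin M → Multisection) : ℕ := ∑ j, (L j).r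

/-- The degree of a multi-section, normalized so that the component `y = φ(x)`,
`φ (x + r) = φ x + d`, has degree `-d`. -/
def degree (L : Fin M → Multisection) : ℤ := -∑ j, (L j).d

/-- The determinant line bundle of the SYZ mirror bundle. -/
def detMirror (L : Fin M → Multisection) (b : Fin M → ℝ) : BundleData :=
  (mirror L b).det (rank L)

/-- The determinant line bundle of the SYZ mirror of the line `𝕃_{r,d}[c]` with the local system
`d + 2πi (b / r) dx`. -/
def detMirrorLine (r : ℕ) (hr : 0 < r) (d : ℤ) (c b : ℝ) : BundleData :=
  detMirror (fun _ : Fin 1 => Multisection.line r hr d c) (fun _ => b)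

end SYZ

end

noncomputable section

namespace SYZ

open TopologicalSpace Complex

/-! ### The covering `ℂ → X̌` -/

/-! Everything is pulled back to `ℂ` and encoded in factors of automorphy for the lattice `ℤ + iℤ`.
On a component of rank `r`, with `a` the integral of `φ` over a period, an explicit gauge turns the
`(0,1)`-part of the connection into the Cauchy–Riemann operator (`holomorphic_iff`). In this gauge
sections are 1-periodic, and translation by `ir` multiplies them by `exp(2πa + 2πib - 2πi d z)`
(`holCoord_add_rank_mul_I`).

The pushforward has the coordinates `h(z), h(z+i), …, h(z+(r-1)i)`. Translation by `i` rotates them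
cyclically, and the coordinate that wraps around picks up the multiplier. The determinant therefore
has factor `(-1)^(r-1)` times that multiplier, and components multiply (`detMirrorUniformization`,
`detMultiplier_eq`). The signs are the source of the `M/2` in the condition on holonomies.

Equal ranks and degrees make the quotient of the two factors a constant `q`. By `isomorphic_iff` the
bundles are isomorphic exactly when some entire nowhere vanishing 1-periodic `u` satisfies `u(z+i) =
q u(z)`. Liouville applied to `u'/u` forces `u` to be an exponential, so `q` must lie in `exp(2πℤ)`
(`exists_multiplier_iff`). The real and imaginary parts of the exponent of `q` give the two
integrality conditions. -/

theorem toMirror_eq_iff {z w : ℂ} :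
    toMirror w = toMirror z ↔ ∃ m n : ℤ, w = z + m + n * I := by
  simp only [toMirror, Prod.mk.injEq, QuotientAddGroup.eq_iff_sub_mem, AddSubgroup.mem_zmultiples_iff]
  constructor
  · rintro ⟨⟨n, hn⟩, ⟨m, hm⟩⟩
    refine ⟨m, n, Complex.ext ?_ ?_⟩
    · simp at hm ⊢; linarith
    · simp at hn ⊢; linarith
  · rintro ⟨m, n, rfl⟩
    exact ⟨⟨n, by simp⟩, ⟨m, by simp⟩⟩

theorem toMirror_add_one (z : ℂ) : toMirror (z + 1) = toMirror z :=
  toMirror_eq_iff.2 ⟨1, 0, by simp⟩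

theorem toMirror_add_I (z : ℂ) : toMirror (z + I) = toMirror z :=
  toMirror_eq_iff.2 ⟨0, 1, by simp⟩

theorem toMirror_add_natCast_mul_I (z : ℂ) (k : ℕ) : toMirror (z + k * I) = toMirror z :=
  toMirror_eq_iff.2 ⟨0, k, by simp⟩

theorem toMirror_surjective : Function.Surjective toMirror := by
  rintro ⟨a, b⟩
  induction a using QuotientAddGroup.induction_on with | H a => ?_
  induction b using QuotientAddGroup.induction_on with | H b => ?_
  exact ⟨⟨b, a⟩, rfl⟩

theorem continuous_toMirror : Continuous toMirror := by
  unfold toMirror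
  exact (AddCircle.continuous_mk' 1 |>.comp continuous_im).prodMk
    (AddCircle.continuous_mk' 1 |>.comp continuous_re)

theorem isOpenMap_toMirror : IsOpenMap toMirror := by
  have h : toMirror = (Prod.map (fun x : ℝ => (x : UnitAddCircle))
      (fun x : ℝ => (x : UnitAddCircle))) ∘ Prod.swap ∘ equivRealProdCLM := by
    ext z <;> rfl
  rw [h]
  exact (QuotientAddGroup.isOpenMap_coe.prodMap QuotientAddGroup.isOpenMap_coe).comp
    ((Homeomorph.prodComm ℝ ℝ).isOpenMap.comp equivRealProdCLM.toHomeomorph.isOpenMap)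

theorem isOpen_preimage (U : Opens MirrorCurve) : IsOpen (toMirror ⁻¹' (U : Set MirrorCurve)) :=
  U.isOpen.preimage continuous_toMirror

/-- A statement about points of `ℂ` which is invariant under translations by `1` and `i` only
depends on the image of the point in `X̌`. -/
theorem invariant_of_toMirror_eq {P : ℂ → Prop} (h1 : ∀ z, P (z + 1) ↔ P z)
    (hI : ∀ z, P (z + I) ↔ P z) {z w : ℂ} (h : toMirror w = toMirror z) : P w ↔ P z := by
  have key {c : ℂ} (hc : ∀ z, P (z + c) ↔ P z) (n : ℤ) : ∀ z, P (z + n * c) ↔ P z := by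
    induction n using Int.induction_on with
    | zero => simp
    | succ k ih =>
      intro z
      have := hc (z + k * c)
      rw [add_assoc, ← add_one_mul] at this
      exact_mod_cast this.trans (by exact_mod_cast ih z)
    | pred k ih =>
      intro z
      have := hc (z + (-k - 1 : ℤ) * c)
      rw [add_assoc, ← add_one_mul] at this
      exact this.symm.trans (by simpa using ih z)
  obtain ⟨m, n, rfl⟩ := toMirror_eq_iff.1 h
  rw [key hI, ← mul_one (m : ℂ), key h1]

/-- The image in `X̌` of a disc in `ℂ` on which the covering `ℂ → X̌` is injective. -/
def disc (z₀ : ℂ) : Opens MirrorCurve :=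
  ⟨toMirror '' Metric.ball z₀ (1 / 4), isOpenMap_toMirror _ Metric.isOpen_ball⟩

theorem mem_disc (z₀ : ℂ) : toMirror z₀ ∈ disc z₀ :=
  ⟨z₀, Metric.mem_ball_self (by norm_num), rfl⟩

/-- Two points of the disc are less than `1/2` apart, whereas a nonzero Gaussian integer has norm at
least `1`. -/
theorem injOn_toMirror (z₀ : ℂ) : Set.InjOn toMirror (Metric.ball z₀ (1 / 4)) := by
  intro w hw z hz h
  obtain ⟨m, n, rfl⟩ := toMirror_eq_iff.1 h
  have hd : ‖(m : ℂ) + n * I‖ < 1 := by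
    have := dist_triangle_right (z + m + n * I) z z₀
    rw [Metric.mem_ball] at hw hz
    rw [dist_eq_norm, show z + m + n * I - z = m + n * I by ring] at this
    linarith
  have hm := (abs_re_le_norm _).trans_lt hd
  have hn := (abs_im_le_norm _).trans_lt hd
  simp only [add_re, intCast_re, mul_re, intCast_im, I_re, I_im, add_im, mul_im] at hm hn
  norm_num at hm hn
  norm_cast at hm hn
  rw [Int.abs_lt_one_iff] at hm hn
  simp [hm, hn]

theorem differentiableOn_preimage_iff {W : Type*} [NormedAddCommGroup W] [NormedSpace ℂ W]
    {U : Opens MirrorCurve} {f : ℂ → W} :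
    DifferentiableOn ℂ f (toMirror ⁻¹' (U : Set MirrorCurve)) ↔
      ∀ z, toMirror z ∈ U → DifferentiableAt ℂ f z :=
  ⟨fun h _ hz => h.differentiableAt ((isOpen_preimage U).mem_nhds hz),
    fun h z hz => (h z hz).differentiableWithinAt⟩

theorem differentiableAt_add_right {W : Type*} [NormedAddCommGroup W] [NormedSpace ℂ W]
    {f : ℂ → W} {z c : ℂ} :
    DifferentiableAt ℂ (fun w => f (w + c)) z ↔ DifferentiableAt ℂ f (z + c) :=
  differentiableAt_comp_add_const

/-! ### Bundles trivialized on the universal covering -/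

/-- A trivialization of the pullback of `E` to the universal covering `ℂ` of `X̌`, with fibre `W`,
such that the holomorphic sections are those with holomorphic coordinates. -/
structure Uniformization (E : BundleData) (W : Type*) [NormedAddCommGroup W]
    [NormedSpace ℂ W] where
  τ : ∀ z : ℂ, E.fiber (toMirror z) ≃ₗ[ℂ] W
  -- Only differentiability is required to be translation invariant, so no matrix-valued multiplier
  -- has to be named in higher rank.
  add_one : ∀ (s : ∀ p, E.fiber p) (z : ℂ),
    DifferentiableAt ℂ (fun w => τ w (s (toMirror w))) (z + 1) ↔
      DifferentiableAt ℂ (fun w => τ w (s (toMirror w))) z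
  add_I : ∀ (s : ∀ p, E.fiber p) (z : ℂ),
    DifferentiableAt ℂ (fun w => τ w (s (toMirror w))) (z + I) ↔
      DifferentiableAt ℂ (fun w => τ w (s (toMirror w))) z
  isHol_iff : ∀ (U : Opens MirrorCurve) (s : ∀ p, E.fiber p),
    E.IsHol U s ↔ ∀ z, toMirror z ∈ U → DifferentiableAt ℂ (fun w => τ w (s (toMirror w))) z

namespace Uniformization

variable {E : BundleData} {W : Type*} [NormedAddCommGroup W] [NormedSpace ℂ W]
  (T : Uniformization E W)

/-- The coordinates of a section, as a function on the universal covering. -/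
def coord (s : ∀ p, E.fiber p) (z : ℂ) : W := T.τ z (s (toMirror z))

theorem isHol_iff_coord {U : Opens MirrorCurve} {s : ∀ p, E.fiber p} :
    E.IsHol U s ↔ ∀ z, toMirror z ∈ U → DifferentiableAt ℂ (T.coord s) z := T.isHol_iff U s

theorem differentiableAt_coord_iff (s : ∀ p, E.fiber p) {z w : ℂ}
    (h : toMirror w = toMirror z) :
    DifferentiableAt ℂ (T.coord s) w ↔ DifferentiableAt ℂ (T.coord s) z :=
  invariant_of_toMirror_eq (P := fun z => DifferentiableAt ℂ (T.coord s) z)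
    (T.add_one s) (T.add_I s) h

/-- Holomorphy of sections over an open subset of a disc can be checked on one sheet. -/
theorem isHol_of_disc {z₀ : ℂ} {V : Opens MirrorCurve} (hV : V ≤ disc z₀) {s : ∀ p, E.fiber p}
    (h : ∀ z ∈ Metric.ball z₀ (1 / 4), toMirror z ∈ V → DifferentiableAt ℂ (T.coord s) z) :
    E.IsHol V s := by
  rw [T.isHol_iff_coord]
  intro z hz
  obtain ⟨w, hw, hwz⟩ := hV hz
  exact (T.differentiableAt_coord_iff s hwz).1 (h w hw (by rwa [hwz]))

/-- A section with prescribed coordinates on a disc. -/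
theorem exists_section (z₀ : ℂ) (G : ℂ → W) : ∃ s : ∀ p, E.fiber p,
    ∀ z ∈ Metric.ball z₀ (1 / 4), T.coord s z = G z := by
  -- The value at `q` is prescribed through any lift in the disc; injectivity leaves at most one, so
  -- there is no conflict.
  have h : ∀ q, ∃ v : E.fiber q, ∀ z ∈ Metric.ball z₀ (1 / 4), ∀ h : toMirror z = q,
      v = h ▸ (T.τ z).symm (G z) := by
    intro q
    by_cases hq : q ∈ disc z₀
    · obtain ⟨w, hw, rfl⟩ := hq
      refine ⟨(T.τ w).symm (G w), fun z hz h => ?_⟩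
      obtain rfl := injOn_toMirror z₀ hz hw h
      rfl
    · exact ⟨0, fun z hz h => (hq ⟨z, hz, h⟩).elim⟩
  choose s hs using h
  refine ⟨s, fun z hz => ?_⟩
  rw [coord, hs _ z hz rfl]
  simp

theorem exists_holomorphic_section {z₀ : ℂ} {V : Opens MirrorCurve} (hV : V ≤ disc z₀)
    (G : ℂ → W) (hG : ∀ z ∈ Metric.ball z₀ (1 / 4), toMirror z ∈ V → DifferentiableAt ℂ G z) :
    ∃ s : ∀ p, E.fiber p, E.IsHol V s ∧ ∀ z ∈ Metric.ball z₀ (1 / 4), T.coord s z = G z := by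
  obtain ⟨s, hs⟩ := T.exists_section z₀ G
  refine ⟨s, T.isHol_of_disc hV fun z hz hzV => ?_, hs⟩
  refine (hG z hz hzV).congr_of_eventuallyEq ?_
  filter_upwards [Metric.isOpen_ball.mem_nhds hz] with w hw using hs w hw

end Uniformization

/-- The trivial line bundle. -/
def trivialBundle : BundleData where
  fiber _ := ℂ
  IsHol U f := IsHolomorphicFunction U f

/-- The tautological uniformization of the trivial line bundle. -/
def trivialUniformization : Uniformization trivialBundle ℂ where
  τ _ := LinearEquiv.refl ℂ ℂ
  add_one s z := by
    rw [← differentiableAt_add_right]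
    exact iff_of_eq (congrArg (DifferentiableAt ℂ · z)
      (funext fun w => congrArg s (toMirror_add_one w)))
  add_I s z := by
    rw [← differentiableAt_add_right]
    exact iff_of_eq (congrArg (DifferentiableAt ℂ · z)
      (funext fun w => congrArg s (toMirror_add_I w)))
  isHol_iff U s := differentiableOn_preimage_iff

/-- Functions are sections of the trivial bundle. This supplies the coefficients with respect to
local frames. -/
theorem exists_holomorphicFunction {z₀ : ℂ} {V : Opens MirrorCurve} (hV : V ≤ disc z₀)
    (G : ℂ → ℂ) (hG : ∀ z ∈ Metric.ball z₀ (1 / 4), toMirror z ∈ V → DifferentiableAt ℂ G z) :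
    ∃ a : MirrorCurve → ℂ, IsHolomorphicFunction V a ∧
      ∀ z ∈ Metric.ball z₀ (1 / 4), a (toMirror z) = G z :=
  trivialUniformization.exists_holomorphic_section hV G hG

/-! ### Holomorphic line bundles and their multipliers -/

namespace Uniformization

variable {E F : BundleData}

/-- On a disc, the section with coordinate `1` is a frame, and the coefficient of any other section
is its own coordinate. -/
theorem isHolomorphicLineBundle (T : Uniformization E ℂ) : E.IsHolomorphicLineBundle := by
  intro p
  obtain ⟨z₀, rfl⟩ := toMirror_surjective p
  obtain ⟨e, he, he1⟩ := T.exists_holomorphic_section (le_refl (disc z₀)) (fun _ => 1)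
    (fun _ _ _ => differentiableAt_const _)
  have key (s : ∀ p, E.fiber p) (z : ℂ) (hz : z ∈ Metric.ball z₀ (1 / 4)) :
      s (toMirror z) = T.coord s z • e (toMirror z) := by
    apply (T.τ z).injective
    rw [map_smul]
    change T.coord s z = T.coord s z • T.coord e z
    simp [he1 z hz]
  refine ⟨disc z₀, mem_disc z₀, fun _ => e, ?_, ?_⟩
  · rintro q ⟨z, hz, rfl⟩
    have hne : e (toMirror z) ≠ 0 := by
      intro h
      have := he1 z hz
      simp [coord, h] at this
    refine ⟨LinearIndependent.of_subsingleton 0 hne, ?_⟩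
    rw [Set.range_const, Submodule.eq_top_iff']
    intro v
    rw [Submodule.mem_span_singleton]
    refine ⟨T.τ z v, (T.τ z).injective ?_⟩
    rw [map_smul]
    change T.τ z v • T.coord e z = _
    simp [he1 z hz]
  · intro V hV s
    constructor
    · intro hs
      rw [T.isHol_iff_coord] at hs
      obtain ⟨a, ha, has⟩ := exists_holomorphicFunction hV (T.coord s) (fun z _ hz => hs z hz)
      refine ⟨fun _ => a, fun _ => ha, fun q hq => ?_⟩
      obtain ⟨z, hz, rfl⟩ := hV hq
      simp [has z hz, key s z hz]
    · rintro ⟨a, ha, has⟩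
      rw [T.isHol_iff_coord]
      intro z hz
      have h1 := differentiableOn_preimage_iff.1 (ha 0) z hz
      have h2 := T.isHol_iff_coord.1 he z (hV hz)
      refine (h1.mul h2).congr_of_eventuallyEq ?_
      filter_upwards [(isOpen_preimage V).mem_nhds hz] with w hw
      simp [coord, has _ hw]

end Uniformization

/-- A uniformization of a line bundle, with factor of automorphy `1` for the translation by `1` and
`δ` for the translation by `i`. -/
structure LineUniformization (E : BundleData) (δ : ℂ → ℂ) extends Uniformization E ℂ where
  coord_add_one : ∀ s z, toUniformization.coord s (z + 1) = toUniformization.coord s z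
  coord_add_I : ∀ s z, toUniformization.coord s (z + I) = δ z * toUniformization.coord s z

namespace LineUniformization

/-- The holomorphy of the coordinates of a section is automatically invariant under translations. -/
def mk' {E : BundleData} {δ : ℂ → ℂ} (hδ : Differentiable ℂ δ) (hδ0 : ∀ z, δ z ≠ 0)
    (τ : ∀ z : ℂ, E.fiber (toMirror z) ≃ₗ[ℂ] ℂ)
    (add_one : ∀ (s : ∀ p, E.fiber p) z,
      τ (z + 1) (s (toMirror (z + 1))) = τ z (s (toMirror z)))
    (add_I : ∀ (s : ∀ p, E.fiber p) z,
      τ (z + I) (s (toMirror (z + I))) = δ z * τ z (s (toMirror z)))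
    (isHol_iff : ∀ (U : Opens MirrorCurve) (s : ∀ p, E.fiber p),
      E.IsHol U s ↔
        ∀ z, toMirror z ∈ U → DifferentiableAt ℂ (fun w => τ w (s (toMirror w))) z) :
    LineUniformization E δ where
  τ := τ
  add_one s z := by
    rw [← differentiableAt_add_right]
    simp only [add_one]
  add_I s z := by
    rw [← differentiableAt_add_right]
    simp only [add_I]
    refine ⟨fun h => ?_, fun h => (hδ z).mul h⟩
    refine (((hδ z).inv (hδ0 z)).mul h).congr_of_eventuallyEq (.of_forall fun w => ?_)
    simp [hδ0]
  isHol_iff := isHol_iff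
  coord_add_one := add_one
  coord_add_I := add_I

variable {E F : BundleData} {ε δ : ℂ → ℂ}

/-- Two line bundles on `X̌` with given multipliers are isomorphic if and only if the multipliers
are cohomologous. -/
theorem isomorphic_iff (S : LineUniformization E ε) (T : LineUniformization F δ)
    (hδ : ∀ z, δ z ≠ 0) :
    E.Isomorphic F ↔ ∃ u : ℂ → ℂ, Differentiable ℂ u ∧ (∀ z, u z ≠ 0) ∧
      (∀ z, u (z + 1) = u z) ∧ ∀ z, u (z + I) * ε z = δ z * u z := by
  constructor
  · rintro ⟨Φ, hΦ⟩
    -- The isomorphism in coordinates: a linear map between lines is multiplication by a number.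
    let u : ℂ → ℂ := fun z => T.τ z (Φ _ ((S.τ z).symm 1))
    have hu (s : ∀ p, E.fiber p) (z : ℂ) :
        T.coord (fun p => Φ p (s p)) z = u z * S.coord s z := by
      have : s (toMirror z) = S.coord s z • (S.τ z).symm 1 := by
        apply (S.τ z).injective
        simp [Uniformization.coord]
      simp only [Uniformization.coord, u]
      rw [this]
      simp [Uniformization.coord, mul_comm]
    have hex (z : ℂ) : ∃ s : ∀ p, E.fiber p, S.coord s z = 1 := by
      obtain ⟨s, hs⟩ := S.exists_section z (fun _ => 1)
      exact ⟨s, hs z (Metric.mem_ball_self (by norm_num))⟩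
    refine ⟨u, fun z => ?_, fun z h => ?_, fun z => ?_, fun z => ?_⟩
    · obtain ⟨e, he, he1⟩ := S.exists_holomorphic_section (le_refl (disc z)) (fun _ => 1)
        (fun _ _ _ => differentiableAt_const _)
      have h1 := T.isHol_iff_coord.1 ((hΦ _ _).1 he) z (mem_disc z)
      refine h1.congr_of_eventuallyEq ?_
      filter_upwards [Metric.isOpen_ball.mem_nhds
        (Metric.mem_ball_self (x := z) (show (0 : ℝ) < 1 / 4 by norm_num))] with w hw
      rw [hu, he1 w hw, mul_one]
    · simp [u] at h
    · obtain ⟨s, hs⟩ := hex z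
      have h1 := T.coord_add_one (fun p => Φ p (s p)) z
      rw [hu, hu, S.coord_add_one, hs] at h1
      simpa using h1
    · obtain ⟨s, hs⟩ := hex z
      have h1 := T.coord_add_I (fun p => Φ p (s p)) z
      rw [hu, hu, S.coord_add_I, hs] at h1
      simpa using h1
  · rintro ⟨u, hud, hu0, hu1, huI⟩
    -- Multiplication by `u z₀` at one chosen lift `z₀` of `p`. The relation for `u` propagates the
    -- formula to all other lifts; phrasing it with sections `s`, `t` avoids transport between
    -- fibres.
    have h : ∀ p, ∃ Φ : E.fiber p ≃ₗ[ℂ] F.fiber p, ∀ (s : ∀ q, E.fiber q) (t : ∀ q, F.fiber q),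
        t p = Φ (s p) → ∀ z, toMirror z = p → T.coord t z = u z * S.coord s z := by
      intro p
      obtain ⟨z₀, rfl⟩ := toMirror_surjective p
      refine ⟨(S.τ z₀).trans ((LinearEquiv.smulOfNeZero ℂ ℂ (u z₀) (hu0 z₀)).trans
        (T.τ z₀).symm), fun s t hst z hz => ?_⟩
      have h0 : T.coord t z₀ = u z₀ * S.coord s z₀ := by
        simp [Uniformization.coord, hst]
      refine (invariant_of_toMirror_eq (P := fun z => T.coord t z = u z * S.coord s z)
        (fun z => ?_) (fun z => ?_) hz).2 h0
      · rw [T.coord_add_one, S.coord_add_one, hu1]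
      · rw [T.coord_add_I, S.coord_add_I, ← mul_assoc, huI, mul_assoc]
        exact mul_right_inj' (hδ z)
    choose Φ hΦ using h
    refine ⟨Φ, fun U s => ?_⟩
    rw [S.isHol_iff_coord, T.isHol_iff_coord]
    have hc : T.coord (fun p => Φ p (s p)) = fun z => u z * S.coord s z := by
      funext z
      exact hΦ (toMirror z) s _ rfl z rfl
    rw [hc]
    refine forall₂_congr fun z _ => ⟨fun h => (hud z).mul h, fun h => ?_⟩
    refine (((hud z).inv (hu0 z)).mul h).congr_of_eventuallyEq (.of_forall fun w => ?_)
    simp [hu0]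

end LineUniformization

/-! ### Determinants -/

/-- The top exterior power of a vector space with coordinates `τ`: `v₁ ∧ … ∧ vₙ` is mapped to the
determinant of the coordinates of the `vᵢ`. -/
def detEquiv {n : ℕ} {V : Type*} [AddCommGroup V] [Module ℂ V] (τ : V ≃ₗ[ℂ] (Fin n → ℂ)) :
    ⋀[ℂ]^n V ≃ₗ[ℂ] ℂ :=
  LinearEquiv.ofLinearMap (exteriorPower.alternatingMapLinearEquiv (Module.Basis.ofEquivFun τ).det)
    (LinearMap.toSpanSingleton ℂ _ (exteriorPower.ιMulti ℂ n (Module.Basis.ofEquivFun τ)))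
    (by
      ext
      have h : (fun i => τ.symm (Pi.single i 1)) = Module.Basis.ofEquivFun τ := by
        funext i
        simp
      have h' := (Module.Basis.ofEquivFun τ).det_self
      rw [← h] at h'
      simpa using h')
    (by
      ext1
      refine Module.Basis.ext_alternating (Module.Basis.ofEquivFun τ) fun v hv => ?_
      -- An injective choice of `n` basis vectors is a permutation, so both sides are its sign times
      -- the value on the basis.
      obtain ⟨σ, rfl⟩ : ∃ σ : Equiv.Perm (Fin n), v = σ :=
        ⟨Equiv.ofBijective v (Finite.injective_iff_bijective.1 hv), rfl⟩
      change LinearMap.toSpanSingleton ℂ _ _ (exteriorPower.alternatingMapLinearEquiv _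
        (exteriorPower.ιMulti ℂ n _)) = exteriorPower.ιMulti ℂ n _
      rw [exteriorPower.alternatingMapLinearEquiv_apply_ιMulti]
      have h1 := (Module.Basis.ofEquivFun τ).det.map_perm (Module.Basis.ofEquivFun τ) σ
      have h2 := (exteriorPower.ιMulti ℂ n (M := V)).map_perm (Module.Basis.ofEquivFun τ) σ
      change (Module.Basis.ofEquivFun τ).det (fun i => Module.Basis.ofEquivFun τ (σ i)) = _ at h1
      change exteriorPower.ιMulti ℂ n (fun i => Module.Basis.ofEquivFun τ (σ i)) = _ at h2
      rw [h1, h2, Module.Basis.det_self]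
      simp [LinearMap.toSpanSingleton_apply])

theorem detEquiv_ιMulti {n : ℕ} {V : Type*} [AddCommGroup V] [Module ℂ V]
    (τ : V ≃ₗ[ℂ] (Fin n → ℂ)) (v : Fin n → V) :
    detEquiv τ (exteriorPower.ιMulti ℂ n v) = (Matrix.of fun i => τ (v i)).det := by
  change exteriorPower.alternatingMapLinearEquiv _ (exteriorPower.ιMulti ℂ n v) = _
  rw [exteriorPower.alternatingMapLinearEquiv_apply_ιMulti, Module.Basis.det_apply,
    ← Matrix.det_transpose]
  congr 1

theorem differentiableAt_matrix_det {n : ℕ} {f : ℂ → Fin n → Fin n → ℂ} {z : ℂ}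
    (h : ∀ i, DifferentiableAt ℂ (fun w => f w i) z) :
    DifferentiableAt ℂ (fun w => (Matrix.of (f w)).det) z := by
  have h' (i j) : DifferentiableAt ℂ (fun w => f w i j) z := differentiableAt_pi.1 (h i) j
  simp only [Matrix.det_apply, Matrix.of_apply]
  refine DifferentiableAt.fun_sum fun σ _ => DifferentiableAt.const_smul ?_ _
  exact DifferentiableAt.fun_finsetProd fun i _ => h' _ _

/-- The determinant of a bundle trivialized on the universal covering, if the determinants of the
coordinates of families of sections have multiplier `δ`. -/
def Uniformization.detLine {E : BundleData} {n : ℕ} (T : Uniformization E (Fin n → ℂ))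
    {δ : ℂ → ℂ} (hδ : Differentiable ℂ δ) (hδ0 : ∀ z, δ z ≠ 0)
    (h1 : ∀ (s : Fin n → ∀ p, E.fiber p) z,
      (Matrix.of fun i => T.coord (s i) (z + 1)).det = (Matrix.of fun i => T.coord (s i) z).det)
    (hI : ∀ (s : Fin n → ∀ p, E.fiber p) z,
      (Matrix.of fun i => T.coord (s i) (z + I)).det =
        δ z * (Matrix.of fun i => T.coord (s i) z).det) :
    LineUniformization (E.det n) δ := by
  -- The top exterior power is a line, so at `z` every element is a multiple of one wedge of
  -- sections. Multipliers thus need checking on pure wedges only.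
  have hframe (z : ℂ) (w : ∀ p, (E.det n).fiber p) : ∃ s : Fin n → ∀ p, E.fiber p,
      (Matrix.of fun i => T.coord (s i) z).det = 1 ∧
      w (toMirror z) = detEquiv (T.τ z) (w (toMirror z)) •
        exteriorPower.ιMulti ℂ n (fun i => s i (toMirror z)) := by
    choose s hs using fun i : Fin n => T.exists_section z (fun _ => Pi.single i 1)
    have hs' (i) : T.coord (s i) z = Pi.single i 1 :=
      hs i z (Metric.mem_ball_self (by norm_num))
    have hdet : (Matrix.of fun i => T.coord (s i) z).det = 1 := by
      rw [← Matrix.det_one (n := Fin n) (R := ℂ)]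
      congr 1
      ext i j
      simp [hs', Matrix.one_apply, Pi.single_apply, eq_comm]
    refine ⟨s, hdet, (detEquiv (T.τ z)).injective ?_⟩
    rw [map_smul, detEquiv_ιMulti]
    change _ = _ • (Matrix.of fun i => T.coord (s i) z).det
    rw [hdet, smul_eq_mul, mul_one]
  have htrans (z z' : ℂ) (w : ∀ p, (E.det n).fiber p) (h : toMirror z' = toMirror z) (c : ℂ)
      (hc : ∀ s : Fin n → ∀ p, E.fiber p, (Matrix.of fun i => T.coord (s i) z').det =
        c * (Matrix.of fun i => T.coord (s i) z).det) :
      detEquiv (T.τ z') (w (toMirror z')) = c * detEquiv (T.τ z) (w (toMirror z)) := by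
    obtain ⟨s, hs, hw⟩ := hframe z w
    have hw' : w (toMirror z') = detEquiv (T.τ z) (w (toMirror z)) •
        exteriorPower.ιMulti ℂ n (fun i => s i (toMirror z')) := by
      generalize detEquiv (T.τ z) (w (toMirror z)) = a at hw
      rw [h]
      exact hw
    rw [hw', map_smul, detEquiv_ιMulti]
    change _ • (Matrix.of fun i => T.coord (s i) z').det = _
    rw [hc, hs, smul_eq_mul]
    ring
  refine LineUniformization.mk' hδ hδ0 (fun z => detEquiv (T.τ z)) (fun w z => ?_)
    (fun w z => htrans _ _ w (toMirror_add_I z) _ fun s => hI s z) fun U w => ⟨?_, ?_⟩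
  · exact (htrans _ _ w (toMirror_add_one z) 1 fun s => by simpa using h1 s z).trans (one_mul _)
  · intro hw z hz
    obtain ⟨V, hzV, -, k, a, e, ha, he, hw⟩ := hw _ hz
    have hsum (y : ℂ) : detEquiv (T.τ y) (∑ m, a m (toMirror y) •
        exteriorPower.ιMulti ℂ n fun i => e m i (toMirror y)) =
        ∑ m, a m (toMirror y) * (Matrix.of fun i => T.coord (e m i) y).det := by
      rw [map_sum]
      refine Finset.sum_congr rfl fun m _ => ?_
      rw [map_smul, detEquiv_ιMulti]
      rfl
    have hd : DifferentiableAt ℂ (fun z => ∑ m, a m (toMirror z) *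
        (Matrix.of fun i => T.coord (e m i) z).det) z := by
      refine DifferentiableAt.fun_sum fun m _ => ?_
      exact (differentiableOn_preimage_iff.1 (ha m) z hzV).mul
        (differentiableAt_matrix_det fun i => T.isHol_iff_coord.1 (he m i) z hzV)
    refine hd.congr_of_eventuallyEq ?_
    filter_upwards [(isOpen_preimage V).mem_nhds hzV] with y hy
    exact (congrArg (detEquiv (T.τ y)) (hw _ hy)).trans (hsum y)
  · intro hw p hp
    obtain ⟨z₀, rfl⟩ := toMirror_surjective p
    have hV : U ⊓ disc z₀ ≤ disc z₀ := inf_le_right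
    -- The frame with standard basis coordinates has determinant `1`, so a single summand with the
    -- coordinate of `w` as coefficient suffices.
    choose e he hes using fun i : Fin n => T.exists_holomorphic_section hV
      (fun _ => Pi.single i 1) (fun _ _ _ => differentiableAt_const _)
    obtain ⟨a, ha, haw⟩ := exists_holomorphicFunction hV
      (fun z => detEquiv (T.τ z) (w (toMirror z))) (fun z _ hz => hw z hz.1)
    refine ⟨U ⊓ disc z₀, ⟨hp, mem_disc z₀⟩, inf_le_left, 1, fun _ => a, fun _ => e,
      fun _ => ha, fun _ => he, ?_⟩
    rintro q ⟨-, z, hz, rfl⟩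
    apply (detEquiv (T.τ z)).injective
    simp only [Finset.univ_unique, Fin.default_eq_zero, Finset.sum_singleton]
    rw [map_smul, detEquiv_ιMulti, haw z hz]
    have hdet : (Matrix.of fun i => T.coord (e i) z).det = 1 := by
      rw [← Matrix.det_one (n := Fin n) (R := ℂ)]
      congr 1
      ext i j
      simp [hes i z hz, Matrix.one_apply, Pi.single_apply, eq_comm]
    change _ = _ • (Matrix.of fun i => T.coord (e i) z).det
    rw [hdet, smul_eq_mul, mul_one]

/-! ### Tensor products -/

/-- The tensor product of two line bundles on `X̌`; the multipliers are multiplied. -/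
def LineUniformization.tensor {E F : BundleData} {ε δ : ℂ → ℂ} (S : LineUniformization E ε)
    (T : LineUniformization F δ) (hε : Differentiable ℂ ε) (hδ : Differentiable ℂ δ)
    (hε0 : ∀ z, ε z ≠ 0) (hδ0 : ∀ z, δ z ≠ 0) :
    LineUniformization (E.tensor F) (fun z => ε z * δ z) := by
  let τ (z : ℂ) : E.fiber (toMirror z) ⊗[ℂ] F.fiber (toMirror z) ≃ₗ[ℂ] ℂ :=
    (TensorProduct.congr (S.τ z) (T.τ z)).trans (TensorProduct.lid ℂ ℂ)
  have hτ (z : ℂ) (s : ∀ p, E.fiber p) (t : ∀ p, F.fiber p) :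
      τ z (s (toMirror z) ⊗ₜ t (toMirror z)) = S.coord s z * T.coord t z := by
    simp [τ, Uniformization.coord]
  have htrans (z z' : ℂ) (w : ∀ p, (E.tensor F).fiber p) (h : toMirror z' = toMirror z) (c : ℂ)
      (hc : ∀ s t, S.coord s z' * T.coord t z' = c * (S.coord s z * T.coord t z)) :
      τ z' (w (toMirror z')) = c * τ z (w (toMirror z)) := by
    obtain ⟨s, hs⟩ := S.exists_section z (fun _ => 1)
    obtain ⟨t, ht⟩ := T.exists_section z (fun _ => 1)
    have hs := hs z (Metric.mem_ball_self (by norm_num))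
    have ht := ht z (Metric.mem_ball_self (by norm_num))
    have hw : w (toMirror z) =
        (τ z (w (toMirror z)) • (s (toMirror z) ⊗ₜ t (toMirror z) : _ ⊗[ℂ] _) : _ ⊗[ℂ] _) := by
      apply (τ z).injective
      rw [map_smul, hτ, hs, ht]
      simp
    have hw' : w (toMirror z') =
        (τ z (w (toMirror z)) • (s (toMirror z') ⊗ₜ t (toMirror z') : _ ⊗[ℂ] _) : _ ⊗[ℂ] _) := by
      generalize τ z (w (toMirror z)) = a at hw
      rw [h]
      exact hw
    rw [hw', map_smul, hτ, hc, hs, ht, smul_eq_mul]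
    ring
  refine LineUniformization.mk' (hε.mul hδ) (fun z => mul_ne_zero (hε0 z) (hδ0 z)) τ
    (fun w z => ?_) (fun w z => htrans _ _ w (toMirror_add_I z) _ fun s t => ?_)
    fun U w => ⟨?_, ?_⟩
  · exact (htrans _ _ w (toMirror_add_one z) 1 fun s t => by
      rw [S.coord_add_one, T.coord_add_one, one_mul]).trans (one_mul _)
  · rw [S.coord_add_I, T.coord_add_I]
    ring
  · intro hw z hz
    obtain ⟨V, hzV, -, k, e, f, he, hf, hw⟩ := hw _ hz
    have hsum (y : ℂ) : τ y (∑ m, e m (toMirror y) ⊗ₜ f m (toMirror y)) =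
        ∑ m, S.coord (e m) y * T.coord (f m) y := by
      rw [map_sum]
      exact Finset.sum_congr rfl fun m _ => hτ _ _ _
    have hd : DifferentiableAt ℂ (fun z => ∑ m, S.coord (e m) z * T.coord (f m) z) z :=
      DifferentiableAt.fun_sum fun m _ => (S.isHol_iff_coord.1 (he m) z hzV).mul
        (T.isHol_iff_coord.1 (hf m) z hzV)
    refine hd.congr_of_eventuallyEq ?_
    filter_upwards [(isOpen_preimage V).mem_nhds hzV] with y hy
    exact (congrArg (τ y) (hw _ hy)).trans (hsum y)
  · intro hw p hp
    obtain ⟨z₀, rfl⟩ := toMirror_surjective p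
    have hV : U ⊓ disc z₀ ≤ disc z₀ := inf_le_right
    -- The first factor absorbs the whole coordinate of `w`, the second is normalized to `1`.
    obtain ⟨e, he, hes⟩ := S.exists_holomorphic_section hV
      (fun z => τ z (w (toMirror z))) (fun z _ hz => hw z hz.1)
    obtain ⟨f, hf, hfs⟩ := T.exists_holomorphic_section hV
      (fun _ => 1) (fun _ _ _ => differentiableAt_const _)
    refine ⟨U ⊓ disc z₀, ⟨hp, mem_disc z₀⟩, inf_le_left, 1, fun _ => e, fun _ => f,
      fun _ => he, fun _ => hf, ?_⟩
    rintro q ⟨-, z, hz, rfl⟩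
    apply (τ z).injective
    simp only [Finset.univ_unique, Fin.default_eq_zero, Finset.sum_singleton]
    rw [hτ, hes z hz, hfs z hz, mul_one]

/-! ### The fibres of the Poincaré bundle -/

/-- Any two lifts differ by a lattice vector, so equivariance determines all values from one. With
`exists_poincareFiber` this makes the fibre a line. -/
theorem poincareFiber_eq_zero {η θ : UnitAddCircle} (u : poincareFiber η θ)
    (v : {v : ℝ × ℝ // (v.1 : UnitAddCircle) = η ∧ (v.2 : UnitAddCircle) = θ})
    (h : u.1 v = 0) : u = 0 := by
  ext w
  obtain ⟨m, hm⟩ := AddSubgroup.mem_zmultiples_iff.1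
    (QuotientAddGroup.eq_iff_sub_mem.1 (w.2.1.trans v.2.1.symm))
  obtain ⟨n, hn⟩ := AddSubgroup.mem_zmultiples_iff.1
    (QuotientAddGroup.eq_iff_sub_mem.1 (w.2.2.trans v.2.2.symm))
  rw [u.2 v w m n (by simp at hm; linarith) (by simp at hn; linarith), h]
  simp

theorem exists_poincareFiber {η θ : UnitAddCircle}
    (v : {v : ℝ × ℝ // (v.1 : UnitAddCircle) = η ∧ (v.2 : UnitAddCircle) = θ}) (c : ℂ) :
    ∃ u : poincareFiber η θ, u.1 v = c := by
  have h1 (w : {v : ℝ × ℝ // (v.1 : UnitAddCircle) = η ∧ (v.2 : UnitAddCircle) = θ}) :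
      ∃ m : ℤ, w.1.1 = v.1.1 + m := by
    obtain ⟨m, hm⟩ := AddSubgroup.mem_zmultiples_iff.1
      (QuotientAddGroup.eq_iff_sub_mem.1 (w.2.1.trans v.2.1.symm))
    exact ⟨m, by simp at hm; linarith⟩
  have h2 (w : {v : ℝ × ℝ // (v.1 : UnitAddCircle) = η ∧ (v.2 : UnitAddCircle) = θ}) :
      ∃ m : ℤ, w.1.2 = v.1.2 + m := by
    obtain ⟨m, hm⟩ := AddSubgroup.mem_zmultiples_iff.1
      (QuotientAddGroup.eq_iff_sub_mem.1 (w.2.2.trans v.2.2.symm))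
    exact ⟨m, by simp at hm; linarith⟩
  choose p hp using h1
  choose q hq using h2
  refine ⟨⟨fun w => exp (I * Real.pi * (q w * v.1.1 - p w * v.1.2 + p w * q w)) * c, ?_⟩, ?_⟩
  · intro w w' m n hm hn
    have hpm : p w' = p w + m := by
      have := (hp w').symm.trans hm
      rw [hp w] at this
      exact_mod_cast (show (p w' : ℝ) = p w + m by linarith)
    have hqn : q w' = q w + n := by
      have := (hq w').symm.trans hn
      rw [hq w] at this
      exact_mod_cast (show (q w' : ℝ) = q w + n by linarith)
    simp only
    rw [← mul_assoc, ← exp_add, hpm, hqn, hp w, hq w]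
    congr 1
    rw [exp_eq_exp_iff_exists_int]
    -- Composing two lattice translations changes the exponent by `2πi · m q`: the term `mn` in the
    -- action corrects the noncommuting factors.
    refine ⟨m * q w, ?_⟩
    push_cast
    ring
  · have hp0 : p v = 0 := by
      have := hp v
      exact_mod_cast (show (p v : ℝ) = 0 by linarith)
    have hq0 : q v = 0 := by
      have := hq v
      exact_mod_cast (show (q v : ℝ) = 0 by linarith)
    simp [hp0, hq0]

/-! ### The holomorphic gauge on the universal covering of a component -/

namespace Multisection

variable (L : Multisection) (b : ℝ)

theorem hasDerivAt_φ (x : ℝ) : HasDerivAt L.φ (deriv L.φ x) x :=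
  (L.smooth.differentiable (by simp) x).hasDerivAt

/-- The primitive of the defining equation. -/
def primitive (x : ℝ) : ℝ := ∫ t in (0 : ℝ)..x, L.φ t

theorem hasDerivAt_primitive (x : ℝ) : HasDerivAt L.primitive (L.φ x) x :=
  (L.smooth.continuous.integral_hasStrictDerivAt 0 x).hasDerivAt

theorem contDiff_primitive : ContDiff ℝ ∞ L.primitive := by
  rw [contDiff_infty_iff_deriv]
  refine ⟨fun x => (L.hasDerivAt_primitive x).differentiableAt, ?_⟩
  rw [show deriv L.primitive = L.φ from funext fun x => (L.hasDerivAt_primitive x).deriv]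
  exact L.smooth

/-- The integral is split at `r` and the second piece shifted back by a period; the resulting `d x`
becomes the imaginary-direction part of `d z` in the multiplier. -/
theorem primitive_add (x : ℝ) :
    L.primitive (x + L.r) = L.primitive L.r + L.primitive x + L.d * x := by
  have hc := L.smooth.continuous
  have h1 := intervalIntegral.integral_add_adjacent_intervals
    (hc.intervalIntegrable (μ := MeasureTheory.volume) 0 L.r)
    (hc.intervalIntegrable L.r (x + L.r))
  have h2 : ∫ t in (L.r : ℝ)..(x + L.r), L.φ t = L.primitive x + L.d * x := by
    have h3 := intervalIntegral.integral_comp_add_right (a := 0) (b := x) L.φ (L.r : ℝ)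
    rw [zero_add] at h3
    rw [← h3]
    simp only [L.map_add]
    rw [intervalIntegral.integral_add (hc.intervalIntegrable _ _) (by simp)]
    simp [primitive, mul_comm]
  rw [primitive, ← h1, h2, add_assoc]
  rfl

/-- Multiplication by `exp (gauge z)` turns holomorphic functions into solutions of the
`(0,1)`-part of the connection. -/
def gauge (z : ℂ) : ℂ :=
  I * Real.pi * (z.re * L.φ z.im : ℝ) - 2 * Real.pi * (L.primitive z.im : ℝ)
    - 2 * Real.pi * I * (b / L.r) * (z.im : ℝ)

theorem contDiff_gauge : ContDiff ℝ ∞ (L.gauge b) := by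
  have h1 : ContDiff ℝ ∞ (fun z : ℂ => z.re) := reCLM.contDiff
  have h2 : ContDiff ℝ ∞ (fun z : ℂ => z.im) := imCLM.contDiff
  have h3 : ContDiff ℝ ∞ (fun x : ℝ => (x : ℂ)) := ofRealCLM.contDiff
  unfold gauge
  exact ((contDiff_const.mul (h3.comp (h1.mul (L.smooth.comp h2)))).sub
    (contDiff_const.mul (h3.comp (L.contDiff_primitive.comp h2)))).sub
    (contDiff_const.mul (h3.comp h2))

theorem fderiv_gauge (z v : ℂ) : fderiv ℝ (L.gauge b) z v =
    I * Real.pi * (v.re * L.φ z.im + z.re * (deriv L.φ z.im * v.im))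
      - 2 * Real.pi * (L.φ z.im * v.im) - 2 * Real.pi * I * (b / L.r) * v.im := by
  have h1 : HasFDerivAt (fun z : ℂ => z.re) reCLM z := reCLM.hasFDerivAt
  have h2 : HasFDerivAt (fun z : ℂ => z.im) imCLM z := imCLM.hasFDerivAt
  have hφ := (L.hasDerivAt_φ z.im).comp_hasFDerivAt z h2
  have hp := (L.hasDerivAt_primitive z.im).comp_hasFDerivAt z h2
  have h3 {f : ℂ → ℝ} {f' : ℂ →L[ℝ] ℝ} (h : HasFDerivAt f f' z) :
      HasFDerivAt (fun z => (f z : ℂ)) (ofRealCLM.comp f') z :=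
    ofRealCLM.hasFDerivAt.comp z h
  have key := (((h3 (h1.mul hφ)).const_mul (I * Real.pi)).sub
    ((h3 hp).const_mul (2 * Real.pi : ℂ))).sub
    ((h3 h2).const_mul (2 * Real.pi * I * (b / L.r)))
  have key' : HasFDerivAt (L.gauge b) _ z := key
  rw [key'.fderiv]
  simp
  ring

/-- The differential of the gauge plus the connection form equals `2πi φ dz`, which is of type
`(1,0)`; hence only the Cauchy–Riemann operator on `h` survives. -/
theorem covDeriv_exp_gauge_mul {h : ℂ → ℂ} {z : ℂ} (hh : DifferentiableAt ℝ h z) (v : ℂ) :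
    covDeriv L b (fun w => exp (L.gauge b w) * h w) z v
      + I * covDeriv L b (fun w => exp (L.gauge b w) * h w) z (I * v)
      = exp (L.gauge b z) * (fderiv ℝ h z v + I * fderiv ℝ h z (I * v)) := by
  have hg : DifferentiableAt ℝ (L.gauge b) z := (L.contDiff_gauge b).differentiable (by simp) z
  have hd := (hg.hasFDerivAt.cexp.mul hh.hasFDerivAt).fderiv
  have hd' (v : ℂ) : fderiv ℝ (fun w => exp (L.gauge b w) * h w) z v =
      exp (L.gauge b z) * fderiv ℝ h z v
        + h z * (exp (L.gauge b z) * fderiv ℝ (L.gauge b) z v) := by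
    have := congrArg (fun f => f v) hd
    simp only [add_apply, FunLike.coe_smul, Pi.smul_apply, smul_eq_mul] at this
    exact this
  simp only [covDeriv, hd', fderiv_gauge]
  simp only [mul_re, mul_im, I_re, I_im, zero_mul, one_mul, zero_sub, zero_add, ofReal_neg]
  ring_nf
  simp only [I_sq]
  ring

/-- After division by `exp (gauge)` the equation is Cauchy–Riemann. Smoothness provides real
differentiability in one direction and is automatic for holomorphic functions in the other. -/
theorem holomorphic_iff {S : Set ℂ} (hS : IsOpen S) (σ : ℂ → ℂ) :
    (ContDiffOn ℝ ∞ σ S ∧ ∀ z ∈ S, ∀ v : ℂ,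
      covDeriv L b σ z v + I * covDeriv L b σ z (I * v) = 0) ↔
    ∀ z ∈ S, DifferentiableAt ℂ (fun w => exp (-L.gauge b w) * σ w) z := by
  have hσ : (fun w => exp (L.gauge b w) * (exp (-L.gauge b w) * σ w)) = σ := by
    funext w
    rw [← mul_assoc, ← exp_add, add_neg_cancel, exp_zero, one_mul]
  have hcr {z : ℂ} (hh : DifferentiableAt ℝ (fun w => exp (-L.gauge b w) * σ w) z) (v : ℂ) :
      covDeriv L b σ z v + I * covDeriv L b σ z (I * v) = exp (L.gauge b z) *
        (fderiv ℝ (fun w => exp (-L.gauge b w) * σ w) z v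
          + I * fderiv ℝ (fun w => exp (-L.gauge b w) * σ w) z (I * v)) := by
    rw [← covDeriv_exp_gauge_mul L b hh v, hσ]
  constructor
  · rintro ⟨hc, h0⟩ z hz
    have hh : DifferentiableAt ℝ (fun w => exp (-L.gauge b w) * σ w) z :=
      (((L.contDiff_gauge b).neg.cexp.contDiffOn.mul hc).contDiffAt
        (hS.mem_nhds hz)).differentiableAt (by simp)
    refine differentiableAt_complex_iff_differentiableAt_real.2 ⟨hh, ?_⟩
    -- The single direction `v = 1` already contains the Cauchy–Riemann equation.
    have h1 := (hcr hh 1).symm.trans (h0 z hz 1)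
    rw [mul_eq_zero, or_iff_right (exp_ne_zero _), mul_one] at h1
    rw [smul_eq_mul]
    linear_combination (-I) * h1 + fderiv ℝ (fun w => exp (-L.gauge b w) * σ w) z I * I_sq
  · intro h
    constructor
    · have h1 : ContDiffOn ℂ ∞ (fun w => exp (-L.gauge b w) * σ w) S :=
        DifferentiableOn.contDiffOn (fun z hz => (h z hz).differentiableWithinAt) hS
      rw [← hσ]
      exact (L.contDiff_gauge b).cexp.contDiffOn.mul (h1.restrict_scalars ℝ)
    · intro z hz v
      rw [hcr ((h z hz).restrictScalars ℝ)]
      rw [(h z hz).fderiv_restrictScalars ℝ]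
      have h2 := (fderiv ℂ (fun w => exp (-L.gauge b w) * σ w) z).map_smul I v
      simp only [smul_eq_mul] at h2
      rw [ContinuousLinearMap.coe_restrictScalars', h2, ← mul_assoc I I, I_mul_I]
      ring

end Multisection

/-! ### Signs of permutations -/

/-- Both sides are homomorphisms on a product of groups, so it suffices to compare them on one
factor, where the permutation is extended by the identity. -/
theorem sign_sigmaCongrRight {α : Type*} {β : α → Type*} [Fintype α] [DecidableEq α]
    [∀ a, Fintype (β a)] [∀ a, DecidableEq (β a)] (σ : ∀ a, Equiv.Perm (β a)) :
    Equiv.Perm.sign (Equiv.Perm.sigmaCongrRight σ) = ∏ a, Equiv.Perm.sign (σ a) := by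
  let f : (∀ a, Equiv.Perm (β a)) →* ℤˣ := Equiv.Perm.sign.comp (Equiv.Perm.sigmaCongrRightHom β)
  let g : (∀ a, Equiv.Perm (β a)) →* ℤˣ :=
    { toFun := fun σ => ∏ a, Equiv.Perm.sign (σ a)
      map_one' := by simp
      map_mul' := fun σ τ => by simp [Finset.prod_mul_distrib] }
  have hfg : f = g := by
    refine MonoidHom.pi_ext fun a τ => ?_
    have h1 : Equiv.Perm.sigmaCongrRight (Pi.mulSingle a τ : ∀ a, Equiv.Perm (β a)) =
        τ.extendDomain (Equiv.sigmaSubtype a).symm := by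
      apply Equiv.ext
      rintro ⟨a', b⟩
      by_cases h : a' = a
      · subst h
        refine Eq.trans ?_ (Equiv.Perm.extendDomain_apply_subtype τ (Equiv.sigmaSubtype a').symm
          (b := ⟨a', b⟩) rfl).symm
        simp
        rfl
      · refine Eq.trans ?_ (Equiv.Perm.extendDomain_apply_not_subtype τ
          (Equiv.sigmaSubtype a).symm (b := ⟨a', b⟩) h).symm
        simp [h]
    have h2 : g (Pi.mulSingle a τ) = Equiv.Perm.sign τ := by
      change ∏ a', Equiv.Perm.sign ((Pi.mulSingle a τ : ∀ a, Equiv.Perm (β a)) a') = _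
      rw [Finset.prod_eq_single a]
      · simp
      · intro a' _ h
        simp [h]
      · simp
    rw [h2]
    change Equiv.Perm.sign (Equiv.Perm.sigmaCongrRight (Pi.mulSingle a τ)) = _
    rw [h1, Equiv.Perm.sign_extendDomain]
  exact DFunLike.congr_fun hfg σ

theorem val_finRotate {n : ℕ} (k : Fin n) :
    (finRotate n k : ℕ) = if (k : ℕ) + 1 = n then 0 else (k : ℕ) + 1 := by
  obtain _ | n := n
  · exact k.elim0
  · rw [coe_finRotate]
    simp [Fin.ext_iff]

/-! ### Quasi-periodicity of the coordinates of sections -/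

variable {M : ℕ} (L : Fin M → Multisection) (b : Fin M → ℝ)

/-- Isolates the dependent-type transport needed to compare values of a section at different
descriptions of the same point. -/
theorem mirrorFiber_congr (s : ∀ p, mirrorFiber L p) {p q : MirrorCurve} (h : p = q)
    {l : {l : TotalDomain L // (L l.1).cover l.2 = p.1}}
    {l' : {l : TotalDomain L // (L l.1).cover l.2 = q.1}} (hl : l.1 = l'.1)
    {v : {v : ℝ × ℝ // (v.1 : UnitAddCircle) = ((L l.1.1).immersion l.1.2).2 ∧
      (v.2 : UnitAddCircle) = p.2}}
    {v' : {v : ℝ × ℝ // (v.1 : UnitAddCircle) = ((L l'.1.1).immersion l'.1.2).2 ∧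
      (v.2 : UnitAddCircle) = q.2}} (hv : v.1 = v'.1) :
    (s p l).1 v = (s q l').1 v' := by
  subst h
  obtain ⟨l, _⟩ := l
  obtain ⟨l', _⟩ := l'
  obtain rfl : l = l' := hl
  obtain rfl : v = v' := Subtype.ext hv
  rfl

theorem pullback_add_one (s : ∀ p, mirrorFiber L p) (j : Fin M) (z : ℂ) :
    pullback L s j (z + 1) = exp (I * Real.pi * (L j).φ z.im) * pullback L s j z := by
  have h := (s (toMirror z) ⟨⟨j, ((z.im : ℝ) : (L j).Domain)⟩, rfl⟩).2
    ⟨((L j).φ z.im, z.re), rfl, rfl⟩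
    ⟨((L j).φ z.im, z.re + 1), rfl, congrArg Prod.snd (toMirror_add_one z)⟩ 0 1
    (by simp) (by simp)
  rw [show I * Real.pi * ((L j).φ z.im) = I * Real.pi * ((1 : ℤ) * (L j).φ z.im
    - (0 : ℤ) * z.re + (0 : ℤ) * (1 : ℤ)) by simp]
  refine Eq.trans ?_ h
  exact mirrorFiber_congr L s (toMirror_add_one z) (by simp) (by simp)

/-- Going once around the component replaces the lift `φ` by `φ + d` and fixes `y̌`, which is the
action of `(d, 0)`; translation by `1` is the action of `(0, 1)`. -/
theorem pullback_add_rank_mul_I (s : ∀ p, mirrorFiber L p) (j : Fin M) (z : ℂ) :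
    pullback L s j (z + (L j).r * I) =
      exp (-(I * Real.pi * (L j).d * z.re)) * pullback L s j z := by
  have hd : (((L j).φ z.im + (L j).d : ℝ) : UnitAddCircle) = ((L j).φ z.im : ℝ) := by
    rw [← (L j).map_add]
    exact congrArg Prod.snd ((L j).periodic z.im)
  have h := (s (toMirror z) ⟨⟨j, ((z.im : ℝ) : (L j).Domain)⟩, rfl⟩).2
    ⟨((L j).φ z.im, z.re), rfl, rfl⟩
    ⟨((L j).φ z.im + (L j).d, z.re), hd, rfl⟩ (L j).d 0
    (by simp) (by simp)
  rw [show -(I * Real.pi * (L j).d * z.re) = I * Real.pi * ((0 : ℤ) * (L j).φ z.im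
    - (L j).d * z.re + (L j).d * (0 : ℤ)) by simp; ring]
  refine Eq.trans ?_ h
  refine mirrorFiber_congr L s (toMirror_add_natCast_mul_I z _) ?_ ?_
  · simp
  · simp [(L j).map_add]

namespace Multisection

/-- The multiplier of the mirror of a component, as a line bundle on the quotient of `ℂ` by
`ℤ + i r ℤ`. -/
def multiplier (L : Multisection) (b : ℝ) (z : ℂ) : ℂ :=
  exp (2 * Real.pi * (L.primitive L.r : ℝ) + 2 * Real.pi * I * b - 2 * Real.pi * I * L.d * z)

theorem differentiable_multiplier (L : Multisection) (b : ℝ) :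
    Differentiable ℂ (L.multiplier b) := by
  unfold multiplier
  fun_prop

end Multisection

/-- The holomorphic coordinate of a section of the mirror bundle on the component `L j`. -/
def holCoord (s : ∀ p, mirrorFiber L p) (j : Fin M) (z : ℂ) : ℂ :=
  exp (-(L j).gauge (b j) z) * pullback L s j z

theorem holCoord_add_one (s : ∀ p, mirrorFiber L p) (j : Fin M) (z : ℂ) :
    holCoord L b s j (z + 1) = holCoord L b s j z := by
  rw [holCoord, holCoord, pullback_add_one, ← mul_assoc, ← exp_add]
  congr 2
  simp [Multisection.gauge]
  ring

/-- The Poincaré bundle contributes `-iπ d y̌`, the gauge `-iπ d y̌ + 2π d x`; together they form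
the holomorphic term `-2πi d z`. The constants come from the integral over a period and the
holonomy. -/
theorem holCoord_add_rank_mul_I (s : ∀ p, mirrorFiber L p) (j : Fin M) (z : ℂ) :
    holCoord L b s j (z + (L j).r * I) = (L j).multiplier (b j) z * holCoord L b s j z := by
  rw [holCoord, holCoord, pullback_add_rank_mul_I, ← mul_assoc, ← mul_assoc, Multisection.multiplier,
    ← exp_add, ← exp_add]
  congr 2
  have hr : ((L j).r : ℂ) ≠ 0 := by exact_mod_cast (L j).r_pos.ne'
  have hz : z = z.re + z.im * I := (re_add_im z).symm
  simp [Multisection.gauge, (L j).map_add, (L j).primitive_add]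
  generalize z.re = x at *
  generalize z.im = y at *
  rw [hz]
  field_simp
  ring_nf
  simp only [I_sq]
  ring

theorem mirror_isHol_iff (U : Opens MirrorCurve) (s : ∀ p, mirrorFiber L p) :
    (mirror L b).IsHol U s ↔
      ∀ j, ∀ z, toMirror z ∈ U → DifferentiableAt ℂ (holCoord L b s j) z :=
  forall_congr' fun j => (L j).holomorphic_iff (b j) (isOpen_preimage U) _

theorem differentiableAt_holCoord_add_one (s : ∀ p, mirrorFiber L p) (j : Fin M) (z : ℂ) :
    DifferentiableAt ℂ (holCoord L b s j) (z + 1) ↔ DifferentiableAt ℂ (holCoord L b s j) z := by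
  rw [← differentiableAt_add_right]
  simp only [holCoord_add_one]

theorem differentiableAt_holCoord_add_rank_mul_I (s : ∀ p, mirrorFiber L p) (j : Fin M) (z : ℂ) :
    DifferentiableAt ℂ (holCoord L b s j) (z + (L j).r * I) ↔
      DifferentiableAt ℂ (holCoord L b s j) z := by
  have hd := (L j).differentiable_multiplier (b j)
  rw [← differentiableAt_add_right]
  simp only [holCoord_add_rank_mul_I]
  refine ⟨fun h => ?_, fun h => (hd z).mul h⟩
  refine (((hd z).inv (exp_ne_zero _)).mul h).congr_of_eventuallyEq (.of_forall fun w => ?_)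
  simp [Multisection.multiplier]

/-! ### Coordinates on the fibres of the mirror bundle -/

/-- The sheet is the remainder modulo `r` of the integer `y - x`. -/
theorem exists_sheet {r : ℕ} (hr : 0 < r) {x y : ℝ} (h : (y : UnitAddCircle) = x) :
    ∃ k : Fin r, ((x + (k : ℕ) : ℝ) : AddCircle (r : ℝ)) = y := by
  obtain ⟨n, hn⟩ := AddSubgroup.mem_zmultiples_iff.1 (QuotientAddGroup.eq_iff_sub_mem.1 h)
  have hr' : (0 : ℤ) < r := by exact_mod_cast hr
  have h0 := Int.emod_nonneg n hr'.ne'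
  have h1 := Int.emod_lt_of_pos n hr'
  refine ⟨⟨(n % r).toNat, by omega⟩, ?_⟩
  refine QuotientAddGroup.eq_iff_sub_mem.2 (AddSubgroup.mem_zmultiples_iff.2 ⟨-(n / r), ?_⟩)
  have h2 : (((n % r).toNat : ℕ) : ℝ) = (n : ℝ) - r * (n / r : ℤ) := by
    have h3 : (((n % r).toNat : ℕ) : ℤ) = n - r * (n / r) := by
      rw [Int.toNat_of_nonneg h0, Int.emod_def]
    exact_mod_cast h3
  simp only [zsmul_eq_mul, mul_one] at hn ⊢
  rw [h2]
  push_cast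
  linarith

theorem sheet_injective {r : ℕ} {x : ℝ} {k k' : Fin r}
    (h : ((x + (k : ℕ) : ℝ) : AddCircle (r : ℝ)) = (x + (k' : ℕ) : ℝ)) : k = k' := by
  obtain ⟨n, hn⟩ := AddSubgroup.mem_zmultiples_iff.1 (QuotientAddGroup.eq_iff_sub_mem.1 h)
  simp only [zsmul_eq_mul, add_sub_add_left_eq_sub] at hn
  have hn' : n * (r : ℤ) = k - k' := by exact_mod_cast hn
  have hk := k.2
  have hk' := k'.2
  have h0 : n = 0 := by
    rcases lt_trichotomy n 0 with h | h | h
    · nlinarith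
    · exact h
    · nlinarith
  rw [h0] at hn'
  ext
  omega

/-- The point of the domain above `x` on the `k`-th sheet of the component `L j`. -/
def sheet (p : MirrorCurve) (x : ℝ) (hx : (x : UnitAddCircle) = p.1) (i : Σ j, Fin (L j).r) :
    {l : TotalDomain L // (L l.1).cover l.2 = p.1} :=
  ⟨⟨i.1, ((x + (i.2 : ℕ) : ℝ) : (L i.1).Domain)⟩, by
    rw [← hx]
    have h := congrArg Prod.fst (toMirror_add_natCast_mul_I ⟨0, x⟩ i.2)
    simp only [toMirror, add_im, mul_im, natCast_re, natCast_im, I_im, I_re, mul_one, zero_mul,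
      add_zero] at h
    exact h⟩

theorem sheet_bijective (p : MirrorCurve) (x : ℝ) (hx : (x : UnitAddCircle) = p.1) :
    Function.Bijective (sheet L p x hx) := by
  constructor
  · rintro ⟨j, k⟩ ⟨j', k'⟩ h
    have h := Sigma.mk.inj_iff.1 (Subtype.ext_iff.1 h)
    obtain ⟨h1, h2⟩ := h
    obtain rfl : j = j' := h1
    exact congrArg (Sigma.mk j) (sheet_injective (eq_of_heq h2))
  · rintro ⟨⟨j, l⟩, hl⟩
    induction l using QuotientAddGroup.induction_on with | H y => ?_
    obtain ⟨k, hk⟩ := exists_sheet (L j).r_pos (show (y : UnitAddCircle) = x from hl.trans hx.symm)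
    exact ⟨⟨j, k⟩, Subtype.ext (Sigma.ext rfl (heq_of_eq hk))⟩

/-- The holomorphic coordinates on the fibre of the mirror bundle over `z`. -/
def fiberCoord (z : ℂ) : mirrorFiber L (toMirror z) ≃ₗ[ℂ] ((Σ j, Fin (L j).r) → ℂ) :=
  LinearEquiv.ofBijective
    { toFun := fun u i => exp (-(L i.1).gauge (b i.1) (z + (i.2 : ℕ) * I)) *
        (u (sheet L (toMirror z) z.im rfl i)).1
          ⟨((L i.1).φ (z.im + (i.2 : ℕ)), z.re), rfl, rfl⟩
      map_add' := fun u v => by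
        ext i
        simp [mul_add]
      map_smul' := fun c u => by
        ext i
        simp [mul_left_comm] }
    (by
      constructor
      · rw [← LinearMap.ker_eq_bot, LinearMap.ker_eq_bot']
        intro u hu
        funext l
        obtain ⟨i, rfl⟩ := (sheet_bijective L (toMirror z) z.im rfl).2 l
        have := congrFun hu i
        simp only [LinearMap.coe_mk, AddHom.coe_mk, Pi.zero_apply, mul_eq_zero, exp_ne_zero,
          false_or] at this
        exact poincareFiber_eq_zero _ _ this
      · intro c
        have h (l : {l : TotalDomain L // (L l.1).cover l.2 = (toMirror z).1}) :
            ∃ a : poincareFiber ((L l.1.1).immersion l.1.2).2 (toMirror z).2,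
              ∀ i, ∀ h : sheet L (toMirror z) z.im rfl i = l,
              a.1 ⟨((L i.1).φ (z.im + (i.2 : ℕ)), z.re), by subst h; rfl, rfl⟩ =
                exp ((L i.1).gauge (b i.1) (z + (i.2 : ℕ) * I)) * c i := by
          obtain ⟨i, rfl⟩ := (sheet_bijective L (toMirror z) z.im rfl).2 l
          obtain ⟨a, ha⟩ := exists_poincareFiber (η := ((L i.1).immersion
              (sheet L (toMirror z) z.im rfl i).1.2).2) (θ := (toMirror z).2)
            ⟨((L i.1).φ (z.im + (i.2 : ℕ)), z.re), rfl, rfl⟩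
            (exp ((L i.1).gauge (b i.1) (z + (i.2 : ℕ) * I)) * c i)
          refine ⟨a, fun i' h => ?_⟩
          obtain rfl := (sheet_bijective L (toMirror z) z.im rfl).1 h
          exact ha
        choose a ha using h
        refine ⟨a, funext fun i => ?_⟩
        simp only [LinearMap.coe_mk, AddHom.coe_mk]
        rw [ha _ i rfl, ← mul_assoc, ← exp_add]
        simp)

theorem fiberCoord_apply (s : ∀ p, mirrorFiber L p) (z : ℂ) (i : Σ j, Fin (L j).r) :
    fiberCoord L b z (s (toMirror z)) i = holCoord L b s i.1 (z + (i.2 : ℕ) * I) := by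
  change exp _ * _ = exp _ * _
  congr 1
  exact mirrorFiber_congr L s (toMirror_add_natCast_mul_I z _).symm
    (by simp [sheet]) (by simp)

/-! ### The determinant of the mirror bundle -/

/-- The sheets of the components, numbered from `0` to `rank L - 1`. -/
def sheetEquiv : (Σ j, Fin (L j).r) ≃ Fin (rank L) := finSigmaFinEquiv

/-- The mirror bundle, trivialized on the universal covering by the holomorphic coordinates. -/
def mirrorUniformization : Uniformization (mirror L b) (Fin (rank L) → ℂ) :=
  have hdiff (s : ∀ p, mirrorFiber L p) (z : ℂ) :
      DifferentiableAt ℂ (fun w => (fiberCoord L b w).trans (LinearEquiv.funCongrLeft ℂ ℂ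
        (sheetEquiv L).symm) (s (toMirror w))) z ↔
      ∀ j, ∀ k < (L j).r, DifferentiableAt ℂ (holCoord L b s j) (z + (k : ℕ) * I) := by
    rw [differentiableAt_pi, (sheetEquiv L).symm.forall_congr_left, Sigma.forall]
    refine forall_congr' fun j => ⟨fun h k hk => ?_, fun h k => ?_⟩
    · have h := h ⟨k, hk⟩
      rw [← differentiableAt_add_right]
      simpa [LinearEquiv.funCongrLeft_apply, fiberCoord_apply] using h
    · have h := h k k.2
      rw [← differentiableAt_add_right] at h
      simpa [LinearEquiv.funCongrLeft_apply, fiberCoord_apply] using h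
  { τ := fun z => (fiberCoord L b z).trans
      (LinearEquiv.funCongrLeft ℂ ℂ (sheetEquiv L).symm)
    add_one := fun (s : ∀ p, mirrorFiber L p) z => by
      refine (hdiff s _).trans (Iff.trans ?_ (hdiff s z).symm)
      refine forall_congr' fun j => forall₂_congr fun k _ => ?_
      rw [add_right_comm, differentiableAt_holCoord_add_one]
    add_I := fun (s : ∀ p, mirrorFiber L p) z => by
      refine (hdiff s _).trans (Iff.trans ?_ (hdiff s z).symm)
      refine forall_congr' fun j => ?_
      have hper := differentiableAt_holCoord_add_rank_mul_I L b s j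
      constructor
      · intro h k hk
        -- Translation by `i` moves sheet `k` to `k + 1`. Sheet `0` is reached from sheet `r - 1`,
        -- at the cost of a translation by `ir`.
        obtain _ | k := k
        · have h := h ((L j).r - 1) (by omega)
          rw [← hper]
          rw [Nat.cast_sub (L j).r_pos] at h
          convert h using 1
          push_cast
          ring
        · convert h k (by omega) using 1
          push_cast
          ring
      · intro h k hk
        by_cases hk' : k + 1 = (L j).r
        · convert (hper _).2 (h 0 (by omega)) using 1
          rw [← hk']
          push_cast
          ring
        · convert h (k + 1) (by omega) using 1
          push_cast
          ring
    isHol_iff := fun U (s : ∀ p, mirrorFiber L p) => by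
      refine (mirror_isHol_iff L b U s).trans ?_
      refine Iff.trans ⟨fun h z hz => ?_, fun h j z hz => ?_⟩
        (forall₂_congr fun z _ => (hdiff s z).symm)
      · exact fun j k _ => h j _ (by rwa [toMirror_add_natCast_mul_I])
      · simpa using h z hz j 0 (L j).r_pos }

theorem mirrorUniformization_coord (s : ∀ p, (mirror L b).fiber p) (z : ℂ) (i : Σ j, Fin (L j).r) :
    (mirrorUniformization L b).coord s z (sheetEquiv L i) =
      holCoord L b s i.1 (z + (i.2 : ℕ) * I) := by
  refine Eq.trans ?_ (fiberCoord_apply L b s z i)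
  change fiberCoord L b z (s (toMirror z)) ((sheetEquiv L).symm (sheetEquiv L i)) = _
  rw [Equiv.symm_apply_apply]

theorem holCoord_finRotate (s : ∀ p, mirrorFiber L p) (j : Fin M) (k : Fin (L j).r) (z : ℂ) :
    holCoord L b s j (z + I + (k : ℕ) * I) =
      (if (k : ℕ) + 1 = (L j).r then (L j).multiplier (b j) z else 1) *
        holCoord L b s j (z + (finRotate (L j).r k : ℕ) * I) := by
  rw [val_finRotate]
  split_ifs with hk
  · rw [Nat.cast_zero, zero_mul, add_zero, ← holCoord_add_rank_mul_I]
    congr 1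
    have hk' : ((L j).r : ℂ) = (k : ℕ) + 1 := by exact_mod_cast hk.symm
    rw [hk']
    ring
  · rw [one_mul]
    congr 1
    push_cast
    ring

/-- The multiplier of the determinant of the mirror bundle. -/
def detMultiplier (z : ℂ) : ℂ :=
  ∏ j, (-1) ^ ((L j).r - 1) * (L j).multiplier (b j) z

theorem differentiable_detMultiplier : Differentiable ℂ (detMultiplier L b) := by
  unfold detMultiplier
  exact Differentiable.fun_finsetProd fun j _ =>
    ((L j).differentiable_multiplier (b j)).const_mul _

theorem detMultiplier_ne_zero (z : ℂ) : detMultiplier L b z ≠ 0 :=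
  Finset.prod_ne_zero_iff.2 fun j _ => mul_ne_zero (by simp) (exp_ne_zero _)

/-- The determinant of the mirror bundle as a line bundle with multiplier. -/
def detMirrorUniformization : LineUniformization (detMirror L b) (detMultiplier L b) :=
  (mirrorUniformization L b).detLine (differentiable_detMultiplier L b)
    (detMultiplier_ne_zero L b)
    (fun s z => by
      congr 1
      ext i c
      obtain ⟨c, rfl⟩ := (sheetEquiv L).surjective c
      simp only [Matrix.of_apply]
      rw [mirrorUniformization_coord, mirrorUniformization_coord, add_right_comm]
      exact holCoord_add_one L b (s i) c.1 _)
    (fun s z => by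
      let π : Equiv.Perm (Fin (rank L)) := (sheetEquiv L).permCongr
        (Equiv.Perm.sigmaCongrRight fun j => finRotate (L j).r)
      let v : (Σ j, Fin (L j).r) → ℂ := fun i =>
        if (i.2 : ℕ) + 1 = (L i.1).r then (L i.1).multiplier (b i.1) z else 1
      -- Translation by `i` permutes the columns by `π` and scales them by `v`, so the determinant
      -- is multiplied by the sign of `π` times the product of `v`.
      have h : (Matrix.of fun i => (mirrorUniformization L b).coord (s i) (z + I)) =
          Matrix.of fun i c => v ((sheetEquiv L).symm c) *
            ((Matrix.of fun i => (mirrorUniformization L b).coord (s i) z).submatrix id π) i c := by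
        ext i c
        obtain ⟨⟨j, k⟩, rfl⟩ := (sheetEquiv L).surjective c
        have hπ : π (sheetEquiv L ⟨j, k⟩) = sheetEquiv L ⟨j, finRotate (L j).r k⟩ := by
          simp only [π, Equiv.permCongr_apply, Equiv.symm_apply_apply]
          rfl
        simp only [Matrix.of_apply, Matrix.submatrix_apply, id, hπ, Equiv.symm_apply_apply]
        rw [mirrorUniformization_coord, mirrorUniformization_coord]
        exact holCoord_finRotate L b (s i) j k z
      rw [h, Matrix.det_mul_row, Matrix.det_permute', ← mul_assoc]
      congr 1
      rw [(sheetEquiv L).symm.prod_comp v, Fintype.prod_sigma, Equiv.Perm.sign_permCongr,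
        sign_sigmaCongrRight, detMultiplier, Finset.prod_mul_distrib, mul_comm]
      congr 1
      · simp [sign_finRotate]
      · refine Finset.prod_congr rfl fun j _ => ?_
        -- Only the last sheet of each component carries a nontrivial factor.
        rw [Finset.prod_eq_single ⟨(L j).r - 1, Nat.sub_lt (L j).r_pos one_pos⟩]
        · simp [v, Nat.sub_add_cancel (show 1 ≤ (L j).r from (L j).r_pos)]
        · intro k _ hk
          refine if_neg fun h => hk (Fin.ext ?_)
          simp only at h ⊢
          omega
        · simp)

/-! ### Cohomologous multipliers -/

/-- An entire nowhere vanishing function which is periodic in one direction and quasi-periodic in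
the other one has an exponential multiplier. -/
theorem exists_multiplier_iff (q : ℂ) (hq : q ≠ 0) :
    (∃ u : ℂ → ℂ, Differentiable ℂ u ∧ (∀ z, u z ≠ 0) ∧ (∀ z, u (z + 1) = u z) ∧
      ∀ z, u (z + I) = q * u z) ↔ ∃ k : ℤ, q = exp (2 * Real.pi * k) := by
  constructor
  · rintro ⟨u, hu, hu0, hu1, huI⟩
    have hd1 (z : ℂ) : deriv u (z + 1) = deriv u z := by
      rw [← deriv_comp_add_const]
      simp only [hu1]
    have hdI (z : ℂ) : deriv u (z + I) = q * deriv u z := by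
      rw [← deriv_comp_add_const]
      simp only [huI]
      exact deriv_const_mul q (hu z)
    -- The constant `q` drops out of the logarithmic derivative, which is therefore entire and
    -- doubly periodic, hence bounded and constant.
    let g : ℂ → ℂ := fun z => deriv u z / u z
    have hg : Differentiable ℂ g := hu.deriv.div hu hu0
    have hg1 (z : ℂ) : g (z + 1) = g z := by simp only [g, hd1, hu1]
    have hgI (z : ℂ) : g (z + I) = g z := by
      simp only [g, hdI, huI]
      exact mul_div_mul_left _ _ hq
    have hbd : Bornology.IsBounded (Set.range g) := by
      have hK : IsCompact (Set.Icc (0 : ℝ) 1 ×ℂ Set.Icc (0 : ℝ) 1) :=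
        isCompact_Icc.reProdIm isCompact_Icc
      refine (hK.image hg.continuous).isBounded.subset ?_
      rintro _ ⟨z, rfl⟩
      refine ⟨⟨Int.fract z.re, Int.fract z.im⟩, ⟨⟨Int.fract_nonneg _, (Int.fract_lt_one _).le⟩,
        ⟨Int.fract_nonneg _, (Int.fract_lt_one _).le⟩⟩, ?_⟩
      refine (invariant_of_toMirror_eq (P := fun w => g w = g z) (fun w => by rw [hg1])
        (fun w => by rw [hgI]) (toMirror_eq_iff.2 ⟨-⌊z.re⌋, -⌊z.im⌋, ?_⟩)).2 rfl
      apply Complex.ext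
      · simpa using (Int.self_sub_floor z.re).symm.trans (sub_eq_add_neg _ _)
      · simpa using (Int.self_sub_floor z.im).symm.trans (sub_eq_add_neg _ _)
    obtain ⟨c, hc⟩ := hg.exists_const_forall_eq_of_bounded hbd
    have hexp (z : ℂ) : u z = u 0 * exp (c * z) := by
      have hdz (z : ℂ) : HasDerivAt (fun z => u z * exp (-(c * z))) 0 z := by
        have h1 := (hu z).hasDerivAt
        have h2 : HasDerivAt (fun z => exp (-(c * z))) (exp (-(c * z)) * -c) z := by
          have := ((hasDerivAt_id z).const_mul c).neg.cexp
          simpa using this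
        refine (h1.mul h2).congr_deriv ?_
        have : deriv u z = c * u z := by
          rw [← hc z]
          simp [g, hu0]
        rw [this]
        ring
      have := is_const_of_deriv_eq_zero (fun z => (hdz z).differentiableAt)
        (fun z => (hdz z).deriv) z 0
      simp only [mul_zero, neg_zero, exp_zero, mul_one] at this
      rw [← this, mul_assoc, ← exp_add]
      simp
    have h1 := hu1 0
    rw [hexp (0 + 1), zero_add, mul_one] at h1
    have h1 : exp c = 1 := mul_left_cancel₀ (hu0 0) (by rw [h1, mul_one])
    obtain ⟨n, hn⟩ := exp_eq_one_iff.1 h1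
    have h2 := huI 0
    rw [hexp (0 + I), zero_add, mul_comm q] at h2
    -- Periodicity gives `c = 2πi n`, so translation by `i` multiplies by `exp(ci) = exp(-2πn)`.
    refine ⟨-n, ?_⟩
    rw [← mul_left_cancel₀ (hu0 0) h2, hn]
    congr 1
    push_cast
    linear_combination (n * (2 * Real.pi)) * I_sq
  · rintro ⟨k, rfl⟩
    refine ⟨fun z => exp (-(2 * Real.pi * k * I * z)), by fun_prop, fun z => exp_ne_zero _,
      fun z => ?_, fun z => ?_⟩
    · rw [exp_eq_exp_iff_exists_int]
      exact ⟨-k, by push_cast; ring⟩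
    · change exp _ = exp _ * exp _
      rw [← exp_add]
      congr 1
      linear_combination (-(2 * Real.pi * k)) * I_sq

/-- The kernel of `exp` is `2πiℤ`, so the condition says that `α + iβ` is a Gaussian integer. -/
theorem exp_eq_exp_two_pi_mul_iff (α β : ℝ) :
    (∃ k : ℤ, exp (2 * Real.pi * α + 2 * Real.pi * I * β) = exp (2 * Real.pi * k)) ↔
      (∃ n : ℤ, α = n) ∧ ∃ n : ℤ, β = n := by
  have hpi : (Real.pi : ℂ) ≠ 0 := by exact_mod_cast Real.pi_ne_zero
  constructor
  · rintro ⟨k, hk⟩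
    obtain ⟨n, hn⟩ := exp_eq_exp_iff_exists_int.1 hk
    have h : (α : ℂ) + β * I = k + n * I := by
      apply mul_left_cancel₀ (mul_ne_zero two_ne_zero hpi)
      linear_combination hn
    have h1 := congrArg re h
    have h2 := congrArg im h
    simp at h1 h2
    exact ⟨⟨k, h1⟩, ⟨n, h2⟩⟩
  · rintro ⟨⟨k, rfl⟩, ⟨n, rfl⟩⟩
    exact ⟨k, exp_eq_exp_iff_exists_int.2 ⟨n, by push_cast; ring⟩⟩

theorem neg_one_pow_eq_exp (n : ℕ) : (-1 : ℂ) ^ n = exp (Real.pi * I * n) := by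
  rw [← exp_pi_mul_I, ← exp_nat_mul, mul_comm]

/-- Writing each sign as `exp(πi(r - 1))` makes the exponents additive: besides rank and degree,
only the sums of integrals and of holonomies and the number of components enter. -/
theorem detMultiplier_eq (z : ℂ) : detMultiplier L b z =
    exp (2 * Real.pi * (∑ j, (L j).primitive (L j).r : ℝ) + 2 * Real.pi * I * (∑ j, b j : ℝ)
      + 2 * Real.pi * I * degree L * z + Real.pi * I * (rank L - M)) := by
  have h (j : Fin M) : (-1) ^ ((L j).r - 1) * (L j).multiplier (b j) z =
      exp (2 * Real.pi * ((L j).primitive (L j).r : ℝ) + 2 * Real.pi * I * b j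
        - 2 * Real.pi * I * z * (L j).d + Real.pi * I * ((L j).r - 1)) := by
    rw [neg_one_pow_eq_exp, Multisection.multiplier, ← exp_add,
      Nat.cast_sub (show 1 ≤ (L j).r from (L j).r_pos)]
    congr 1
    push_cast
    ring
  simp only [detMultiplier, h]
  rw [← exp_sum]
  congr 1
  simp only [Finset.sum_add_distrib, Finset.sum_sub_distrib, ← Finset.mul_sum, degree, rank]
  push_cast
  simp
  ring

theorem primitive_line (r : ℕ) (hr : 0 < r) (d : ℤ) (c : ℝ) :
    (Multisection.line r hr d c).primitive (Multisection.line r hr d c).r = r * d / 2 + c := by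
  have hr' : (r : ℝ) ≠ 0 := by exact_mod_cast hr.ne'
  change ∫ x in (0 : ℝ)..r, ((d : ℝ) / r * x + c / r) = _
  rw [intervalIntegral.integral_add (Continuous.intervalIntegrable (by fun_prop) _ _) (by simp),
    intervalIntegral.integral_const_mul, integral_id, intervalIntegral.integral_const]
  simp
  field_simp

end SYZ

end

/-! ### Comparison of the two determinants -/

theorem proposition3p1
    (r₁ r₂ : ℕ) (hr₁ : 0 < r₁) (hr₂ : 0 < r₂) (d₁ d₂ : ℤ) (c₁ c₂ b₁ b₂ : ℝ)
    (M : ℕ) (L : Fin M → SYZ.Multisection) (b' : Fin M → ℝ)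
    (hrank : SYZ.rank L = r₁ + r₂) (hdegree : SYZ.degree L = -d₁ - d₂) :
    (SYZ.detMirror L b').IsHolomorphicLineBundle ∧
    ((SYZ.detMirrorLine r₁ hr₁ d₁ c₁ b₁).tensor
      (SYZ.detMirrorLine r₂ hr₂ d₂ c₂ b₂)).IsHolomorphicLineBundle ∧
    ((SYZ.detMirror L b').Isomorphic
        ((SYZ.detMirrorLine r₁ hr₁ d₁ c₁ b₁).tensor (SYZ.detMirrorLine r₂ hr₂ d₂ c₂ b₂)) ↔
      (∃ n : ℤ, (∑ j, ∫ x in (0 : ℝ)..((L j).r : ℝ), (L j).φ x)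
          - (r₁ : ℝ) * d₁ / 2 - (r₂ : ℝ) * d₂ / 2 - c₁ - c₂ = n) ∧
      (∃ n : ℤ, b₁ + b₂ - (M : ℝ) / 2 - ∑ j, b' j = n)) := by
  open SYZ in
  set L₁ : Fin 1 → Multisection := fun _ => Multisection.line r₁ hr₁ d₁ c₁ with hL₁
  set L₂ : Fin 1 → Multisection := fun _ => Multisection.line r₂ hr₂ d₂ c₂ with hL₂
  let S := detMirrorUniformization L b'
  let T : LineUniformization ((detMirrorLine r₁ hr₁ d₁ c₁ b₁).tensor
      (detMirrorLine r₂ hr₂ d₂ c₂ b₂))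
      (fun z => detMultiplier L₁ (fun _ => b₁) z * detMultiplier L₂ (fun _ => b₂) z) :=
    (detMirrorUniformization L₁ fun _ => b₁).tensor (detMirrorUniformization L₂ fun _ => b₂)
      (differentiable_detMultiplier _ _) (differentiable_detMultiplier _ _)
      (detMultiplier_ne_zero _ _) (detMultiplier_ne_zero _ _)
  refine ⟨S.isHolomorphicLineBundle, T.isHolomorphicLineBundle, ?_⟩
  rw [S.isomorphic_iff T fun z => mul_ne_zero (detMultiplier_ne_zero _ _ z)
    (detMultiplier_ne_zero _ _ z)]
  set α : ℝ := (∑ j, ∫ x in (0 : ℝ)..((L j).r : ℝ), (L j).φ x)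
    - (r₁ : ℝ) * d₁ / 2 - (r₂ : ℝ) * d₂ / 2 - c₁ - c₂ with hα
  set β : ℝ := b₁ + b₂ - (M : ℝ) / 2 - ∑ j, b' j with hβ
  -- The terms in `z` cancel by equality of degrees. The signs leave `πi(M - 2)`, from `M`
  -- components against two; with the `M/2` inside `β` this adds up to the integer shift `M - 1`.
  have hratio (z : ℂ) : detMultiplier L₁ (fun _ => b₁) z * detMultiplier L₂ (fun _ => b₂) z =
      Complex.exp (2 * Real.pi * (-α : ℝ) + 2 * Real.pi * Complex.I * (β + M - 1 : ℝ))
        * detMultiplier L b' z := by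
    have h1 : rank L₁ = r₁ := by simp [rank, hL₁, Multisection.line]
    have h2 : rank L₂ = r₂ := by simp [rank, hL₂, Multisection.line]
    have h3 : degree L₁ = -d₁ := by simp [degree, hL₁, Multisection.line]
    have h4 : degree L₂ = -d₂ := by simp [degree, hL₂, Multisection.line]
    have h5 : (∑ j, (L j).primitive (L j).r) =
      α + (r₁ : ℝ) * d₁ / 2 + (r₂ : ℝ) * d₂ / 2 + c₁ + c₂ := by
      simp only [hα, Multisection.primitive]
      ring
    have h6 : ∑ j, b' j = b₁ + b₂ - (M : ℝ) / 2 - β := by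
      rw [hβ]
      ring
    rw [detMultiplier_eq, detMultiplier_eq, detMultiplier_eq, h1, h2, h3, h4, h5, h6, hrank,
      hdegree, ← Complex.exp_add, ← Complex.exp_add]
    congr 1
    simp only [hL₁, hL₂, primitive_line, Finset.univ_unique, Finset.sum_const,
      Finset.card_singleton, one_smul]
    push_cast
    ring
  have hiff := exp_eq_exp_two_pi_mul_iff (-α) (β + M - 1)
  rw [← exists_multiplier_iff _ (Complex.exp_ne_zero _)] at hiff
  refine Iff.trans ?_ (hiff.trans (and_congr ?_ ?_))
  · refine exists_congr fun u => and_congr_right fun _ => and_congr_right fun _ =>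
      and_congr_right fun _ => forall_congr' fun z => ?_
    rw [hratio, mul_right_comm]
    exact mul_left_inj' (detMultiplier_ne_zero L b' z)
  · constructor
    · rintro ⟨n, hn⟩
      exact ⟨-n, by push_cast; linarith⟩
    · rintro ⟨n, hn⟩
      exact ⟨-n, by push_cast; linarith⟩
  · constructor
    · rintro ⟨n, hn⟩
      exact ⟨n - M + 1, by push_cast; linarith⟩
    · rintro ⟨n, hn⟩
      exact ⟨n + M - 1, by push_cast; linarith⟩
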